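/- Indices $i\in\{1,2,3,4\}$ are cyclic. Identify $T^*\mathbb{R}$ with $\mathbb{C}=\mathbb{R}^2$. Let $f_1,f_2,f_3,f_4:\mathbb{R}\to\mathbb{R}$ be such that each $\operatorname{graph}(df_i)$ is a line $y=a_ix+b_i$, and for $\epsilon>0$ put $L_i^\epsilon=\operatorname{graph}(\epsilon\,df_i)$. Assume that $L_i^\epsilon\cap L_{i+1}^\epsilon$ is a single point $x_i^\epsilon$ for each $i$, and that $x_1^\epsilon,x_2^\epsilon,x_3^\epsilon,x_4^\epsilon$ are, in counterclockwise order, the vertices of a (strictly) convex quadrilateral. Let $p_i$ be the critical point of $f_{i+1}-f_i$. For each $\epsilon>0$ let $w_\epsilon$ be the Schwarz–Christoffel map of this quadrilateral: a conformal map from the upper half plane onto the interior of the quadrilateral, extended continuously to the boundary, with $w_\epsilon(z_i)=x_i^\epsilon$ for $i=1,2,3$, where $z_1=1$, $z_2=\infty$, $z_3=0$, with $w_\epsilon(z_{4,\epsilon})=x_4^\epsilon$ for a point $z_{4,\epsilon}\in(0,1)$, and mapping the boundary arc between the $(i-1)$-st and the $i$-th marked point into $L_i^\epsilon$. A *ribbon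 tree* with $4$ exterior vertices is a finite tree without vertices of valency $2$, embedded up to isotopy in the closed disk so that exactly its vertices of valency $1$, numbered $v_1,\dots,v_4$ counterclockwise, lie on the boundary circle. Let $D_i$ be the component of the complement of the tree in the disk that touches the boundary arc from $v_{i-1}$ to $v_i$. A *gradient tree* for $(f_i),(p_i)$ is a ribbon tree $T$ with a length $l(e)>0$ for each interior edge $e$, and a continuous map $I:T\to\mathbb{R}$ with $I(v_i)=p_i$ such that $\frac{d}{dt}I|_{e_i}=-\operatorname{grad}(f_{i+1}-f_i)$ on the exterior edge $e_i\simeq(-\infty,0]$ at $v_i$ (with $v_i$ at $-\infty$), and $\frac{d}{dt}I|_{e}=-\operatorname{grad}(f_{r}-f_{s})$ on each interior edge $e\simeq[0,l(e)]$, oriented so that $D_s$ lies on its left, $D_r$ on its right, and $s<r$. The *tree corresponding to the behaviour of $z_1,z_2,z_3,z_{4,\epsilon}$ as $\epsilon\to+0$* is the following ribbon tree: if $z_{4,\epsilon}\to z_3$, the tree with two interior vertices joined by an edge, where $v_1,v_2$ are attached to one and $v_3,v_4$ to the other; if $z_{4,\epsilon}\to z_1$, the tree with two interior vertices joined by an edge,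 where $v_2,v_3$ are attached to one and $v_4,v_1$ to the other; if there is no collision, i.e. $z_{4,\epsilon}\in[\delta,1-\delta]$ for some $\delta>0$ and all small $\epsilon>0$, the tree with a single interior vertex. Then there is exactly one gradient tree for $(f_i),(p_i)$ (up to isomorphism of ribbon trees preserving lengths and $I$), one of these three behaviours of $z_{4,\epsilon}$ occurs, and the tree corresponding to it is isomorphic, as a ribbon tree with numbered exterior vertices, to the ribbon tree underlying the gradient tree. -/

import Mathlib

open Set Filter Topology

/-! ## Ribbon trees

Indices `0, …, k - 1` in `Fin k` stand for `1, …, k`, and `i + 1` is cyclic. -/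

/-- A ribbon tree with `k` exterior vertices: a finite tree, embedded in the oriented closed disk
so that exactly its vertices with one edge lie on the boundary circle, taken up to isotopy.
The isotopy class of the embedding is recorded by the counterclockwise cyclic order `next` of the
edges at each vertex. The exterior vertices `leaf 0, leaf 1, …` are numbered counterclockwise along
the circle. The complement of the tree in the disk has `k` components; the component
`D i` is the one whose closure contains the boundary arc from `leaf (i - 1)` to `leaf i`, and
`region u v` is the index of the component on the right-hand side of the edge directed from `u`
to `v` (so `region v u` is the one on its left-hand side). -/
structure RibbonTree (k : ℕ) [NeZero k] where
  /-- vertices -/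
  V : Type
  /-- there are finitely many vertices -/
  finite : Finite V
  /-- the underlying graph -/
  graph : SimpleGraph V
  /-- the underlying graph is a tree -/
  isTree : graph.IsTree
  /-- no vertex has exactly two edges -/
  degree_ne_two : ∀ v, (graph.neighborSet v).ncard ≠ 2
  /-- the exterior vertices -/
  leaf : Fin k → V
  leaf_injective : Function.Injective leaf
  /-- the exterior vertices are exactly the vertices with one edge -/
  mem_range_leaf : ∀ v, v ∈ Set.range leaf ↔ (graph.neighborSet v).ncard = 1
  /-- `next v u` is the neighbour of `v` that follows the neighbour `u` counterclockwise -/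
  next : V → V → V
  next_adj : ∀ v u, graph.Adj v u → graph.Adj v (next v u)
  /-- turning counterclockwise about `v` one meets all the edges at `v` -/
  next_cyclic : ∀ v u u', graph.Adj v u → graph.Adj v u' → ∃ n : ℕ, (next v)^[n] u = u'
  /-- the component on the right of a directed edge -/
  region : V → V → Fin k
  /-- arriving at an interior vertex `v` from `u` and taking the first edge to the right, one
  keeps the same component on the right -/
  region_turn : ∀ u v, graph.Adj u v → v ∉ Set.range leaf → region v (next v u) = region u v
  /-- on the right of the edge coming from `leaf i` lies the component after `leaf i` -/
  region_from_leaf : ∀ i u, graph.Adj (leaf i) u → region (leaf i) u = i + 1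
  /-- on the right of the edge going to `leaf i` lies the component before `leaf i` -/
  region_to_leaf : ∀ i u, graph.Adj u (leaf i) → region u (leaf i) = i

namespace RibbonTree

variable {k : ℕ} [NeZero k]

/-- An interior vertex. -/
def IsInternal (T : RibbonTree k) (v : T.V) : Prop := v ∉ Set.range T.leaf

/-- `u → v` is an interior edge with its orientation: the index of the component on its left is
smaller than the index of the component on its right. -/
def IsInternalEdge (T : RibbonTree k) (u v : T.V) : Prop :=
  T.graph.Adj u v ∧ T.IsInternal u ∧ T.IsInternal v ∧ T.region v u < T.region u v

/-- Isomorphisms of ribbon trees: isomorphisms of the trees that respect the numbering of the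
exterior vertices and the cyclic order of the edges at every vertex. -/
structure Iso (T T' : RibbonTree k) where
  /-- the isomorphism of the underlying trees -/
  toGraphIso : T.graph ≃g T'.graph
  map_leaf : ∀ i, toGraphIso (T.leaf i) = T'.leaf i
  map_next : ∀ v u, T.graph.Adj v u →
    toGraphIso (T.next v u) = T'.next (toGraphIso v) (toGraphIso u)

end RibbonTree

/-! ## Gradient trees in the real line -/

/-- A gradient tree for the functions `f i` on `ℝ` (with its standard metric) and the critical
points `p i` of `f (i + 1) - f i`: a ribbon tree with lengths of the interior edges and a continuous
map `I` to `ℝ`. The map is given by its values at the vertices (`node`), its restrictions to the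
exterior edges `e_i ≃ (-∞, 0]`, with `-∞` at `leaf i`, and its restrictions to the oriented interior
edges `e ≃ [0, len e]`. -/
structure GradientTree {k : ℕ} [NeZero k] (f : Fin k → ℝ → ℝ) (p : Fin k → ℝ) where
  /-- the underlying ribbon tree -/
  tree : RibbonTree k
  /-- lengths of the interior edges (the values at other pairs are irrelevant) -/
  len : Sym2 tree.V → ℝ
  len_pos : ∀ u v, tree.IsInternalEdge u v → 0 < len s(u, v)
  /-- the values at the vertices -/
  node : tree.V → ℝ
  node_leaf : ∀ i, node (tree.leaf i) = p i
  /-- the restriction to the exterior edge at `leaf i` -/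
  ext : Fin k → ℝ → ℝ
  ext_tendsto : ∀ i, Tendsto (ext i) atBot (𝓝 (p i))
  ext_zero : ∀ i u, tree.graph.Adj (tree.leaf i) u → ext i 0 = node u
  ext_deriv : ∀ i, ∀ t ∈ Iic (0 : ℝ),
    HasDerivWithinAt (ext i) (-deriv (fun y => f (i + 1) y - f i y) (ext i t)) (Iic 0) t
  /-- the restriction to an interior edge -/
  int : tree.V → tree.V → ℝ → ℝ
  int_zero : ∀ u v, tree.IsInternalEdge u v → int u v 0 = node u
  int_len : ∀ u v, tree.IsInternalEdge u v → int u v (len s(u, v)) = node v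
  int_deriv : ∀ u v, tree.IsInternalEdge u v → ∀ t ∈ Icc 0 (len s(u, v)),
    HasDerivWithinAt (int u v)
      (-deriv (fun y => f (tree.region u v) y - f (tree.region v u) y) (int u v t))
      (Icc 0 (len s(u, v))) t

namespace GradientTree

variable {k : ℕ} [NeZero k] {f : Fin k → ℝ → ℝ} {p : Fin k → ℝ}

/-- Two gradient trees are the same element of the moduli space when an isomorphism of the ribbon
trees preserves the lengths of the interior edges and the map to `ℝ`. -/
structure Iso (A B : GradientTree f p) where
  /-- the isomorphism of the underlying ribbon trees -/
  toTreeIso : A.tree.Iso B.tree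
  map_len : ∀ u v, A.tree.IsInternalEdge u v →
    B.len s(toTreeIso.toGraphIso u, toTreeIso.toGraphIso v) = A.len s(u, v)
  map_node : ∀ v, B.node (toTreeIso.toGraphIso v) = A.node v
  map_ext : ∀ i, ∀ t ∈ Iic (0 : ℝ), B.ext i t = A.ext i t
  map_int : ∀ u v, A.tree.IsInternalEdge u v → ∀ t ∈ Icc 0 (A.len s(u, v)),
    B.int (toTreeIso.toGraphIso u) (toTreeIso.toGraphIso v) t = A.int u v t

end GradientTree

/-! ## Lagrangian sections and holomorphic disks

`T^*ℝ` is identified with `ℂ`: the real part is the base coordinate, the imaginary part the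
fibre coordinate. -/

/-- The Lagrangian section `graph (ε df)`. -/
def lagrangianGraph (ε : ℝ) (f : ℝ → ℝ) : Set ℂ := {z | z.im = ε * deriv f z.re}

/-- The section `graph (df)` is affine, i.e. a line `y = a x + b`. -/
def IsAffineSection (f : ℝ → ℝ) : Prop := ∃ a b : ℝ, ∀ t, HasDerivAt f (a * t + b) t

/-- `x 0, x 1, x 2, x 3` are, in counterclockwise order, the vertices of a convex quadrilateral: for
each side directed from `x i` to `x (i + 1)`, the other two vertices lie strictly on its left. -/
def IsConvexCCW (x : Fin 4 → ℂ) : Prop :=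
  ∀ i j : Fin 4, j ≠ i → j ≠ i + 1 →
    0 < (x (i + 1) - x i).re * (x j - x i).im - (x (i + 1) - x i).im * (x j - x i).re

/-- `w` is the Schwarz-Christoffel map, extended to the closed upper half plane, of the convex
quadrilateral with vertices `x i`, with marked points `z₁ = 1`, `z₂ = ∞`, `z₃ = 0`, `z₄ = ξ`:
a conformal map from the upper half plane onto the interior of the quadrilateral which takes the
marked points to `x 0, x 1, x 2, x 3` and the boundary arc between `z_{i-1}` and `z_i` into the
`i`-th Lagrangian. -/
structure IsSchwarzChristoffel (L : Fin 4 → Set ℂ) (x : Fin 4 → ℂ) (ξ : ℝ) (w : ℂ → ℂ) :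
    Prop where
  differentiableOn : DifferentiableOn ℂ w {z | 0 < z.im}
  injOn : InjOn w {z | 0 < z.im}
  image_eq : w '' {z | 0 < z.im} = interior (convexHull ℝ (Set.range x))
  continuousOn : ContinuousOn w {z | 0 ≤ z.im}
  map_z₁ : w 1 = x 0
  map_z₂ : Tendsto w (cocompact ℂ ⊓ 𝓟 {z | 0 ≤ z.im}) (𝓝 (x 1))
  map_z₃ : w 0 = x 2
  map_z₄ : w (ξ : ℂ) = x 3
  arc₁ : ∀ t : ℝ, ξ < t → t < 1 → w (t : ℂ) ∈ L 0
  arc₂ : ∀ t : ℝ, 1 < t → w (t : ℂ) ∈ L 1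
  arc₃ : ∀ t : ℝ, t < 0 → w (t : ℂ) ∈ L 2
  arc₄ : ∀ t : ℝ, 0 < t → t < ξ → w (t : ℂ) ∈ L 3

/-! ## Trees of degenerations of the half plane with four marked points -/

/-- The tree with four exterior vertices and a single interior vertex. -/
def corolla : RibbonTree 4 where
  V := Option (Fin 4)
  finite := inferInstance
  graph :=
    { Adj := fun u v => u.isSome ≠ v.isSome
      symm := ⟨fun _ _ h => h.symm⟩
      loopless := ⟨fun _ h => h rfl⟩ }
  isTree := by
    classical
    rw [SimpleGraph.isTree_iff_connected_and_card]
    refine ⟨?_, ?_⟩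
    · rw [SimpleGraph.connected_iff_exists_forall_reachable]
      refine ⟨none, fun w => ?_⟩
      rcases w with _ | i
      · exact SimpleGraph.Reachable.refl _
      · exact SimpleGraph.Adj.reachable (by simp)
    · rw [Nat.card_eq_fintype_card, Nat.card_eq_fintype_card]
      decide
  degree_ne_two := by
    intro v
    rw [Set.ncard_eq_toFinset_card']
    revert v
    decide
  leaf := some
  leaf_injective := Option.some_injective _
  mem_range_leaf := by
    intro v
    rw [Set.ncard_eq_toFinset_card']
    revert v
    decide
  next := fun v u =>
    match v, u with
    | none, some i => some (i + 1)
    | _, u => u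
  next_adj := by decide
  next_cyclic := by
    have key : ∀ v u u' : Option (Fin 4), v.isSome ≠ u.isSome → v.isSome ≠ u'.isSome →
        ∃ n : Fin 4, (fun u => (match v, u with
          | none, some i => some (i + 1)
          | _, u => u : Option (Fin 4)))^[(n : ℕ)] u = u' := by decide
    intro v u u' h h'
    obtain ⟨n, hn⟩ := key v u u' h h'
    exact ⟨n, hn⟩
  region := fun u v =>
    match u, v with
    | some i, _ => i + 1
    | none, some i => i
    | none, none => 0
  region_turn := by decide
  region_from_leaf := by decide
  region_to_leaf := by decide

/-- Adjacency in `twoNodeTree j`. -/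
def twoNodeAdj (j : Fin 4) : Fin 4 ⊕ Bool → Fin 4 ⊕ Bool → Bool
  | .inl i, .inr b => decide (i = j + 2 ∨ i = j + 3) == b
  | .inr b, .inl i => decide (i = j + 2 ∨ i = j + 3) == b
  | .inr b, .inr c => b != c
  | .inl _, .inl _ => false

/-- The cyclic orders `j → j + 1 → inr true → j` and `j + 2 → j + 3 → inr false → j + 2` of the
edges at the two interior vertices of `twoNodeTree j`; here `twoNodeNext j v u` is the neighbour of
`v` that follows `u`. -/
def twoNodeNext (j : Fin 4) : Fin 4 ⊕ Bool → Fin 4 ⊕ Bool → Fin 4 ⊕ Bool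
  | .inr b, .inl i => if i = j ∨ i = j + 2 then .inl (i + 1) else .inr (!b)
  | .inr false, .inr _ => .inl j
  | .inr true, .inr _ => .inl (j + 2)
  | .inl _, u => u

/-- The components of the complement of `twoNodeTree j` to the right of the directed edges. -/
def twoNodeRegion (j : Fin 4) : Fin 4 ⊕ Bool → Fin 4 ⊕ Bool → Fin 4
  | .inl i, _ => i + 1
  | .inr _, .inl i => i
  | .inr false, .inr _ => j + 2
  | .inr true, .inr _ => j

/-- The tree with four exterior vertices and two interior vertices joined by an interior edge, in
which the exterior vertices `j`, `j + 1` are attached to one interior vertex (`inr false`) and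
`j + 2`, `j + 3` to the other one (`inr true`). -/
def twoNodeTree (j : Fin 4) : RibbonTree 4 where
  V := Fin 4 ⊕ Bool
  finite := inferInstance
  graph :=
    { Adj := fun u v => twoNodeAdj j u v = true
      symm := by constructor; revert j; decide
      loopless := by constructor; revert j; decide }
  isTree := by
    classical
    rw [SimpleGraph.isTree_iff_connected_and_card]
    refine ⟨?_, ?_⟩
    · rw [SimpleGraph.connected_iff_exists_forall_reachable]
      refine ⟨.inr true, fun w => ?_⟩
      rcases w with i | b
      · refine SimpleGraph.Reachable.trans (v := .inr (decide (i = j + 2 ∨ i = j + 3))) ?_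
          (SimpleGraph.Adj.reachable (by simp [twoNodeAdj]))
        generalize decide (i = j + 2 ∨ i = j + 3) = b
        cases b
        · exact SimpleGraph.Adj.reachable (by simp [twoNodeAdj])
        · exact SimpleGraph.Reachable.refl _
      · cases b
        · exact SimpleGraph.Adj.reachable (by simp [twoNodeAdj])
        · exact SimpleGraph.Reachable.refl _
    · rw [Nat.card_eq_fintype_card, Nat.card_eq_fintype_card]
      revert j
      decide
  degree_ne_two := by
    intro v
    rw [Set.ncard_eq_toFinset_card']
    revert v j
    decide
  leaf := Sum.inl
  leaf_injective := Sum.inl_injective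
  mem_range_leaf := by
    intro v
    rw [Set.ncard_eq_toFinset_card']
    revert v j
    decide
  next := twoNodeNext j
  next_adj := by revert j; decide
  next_cyclic := by
    have key : ∀ j v u u', twoNodeAdj j v u = true → twoNodeAdj j v u' = true →
        ∃ n : Fin 3, (twoNodeNext j v)^[(n : ℕ)] u = u' := by decide
    intro v u u' h h'
    obtain ⟨n, hn⟩ := key j v u u' h h'
    exact ⟨n, hn⟩
  region := twoNodeRegion j
  region_turn := by revert j; decide
  region_from_leaf := by revert j; decide
  region_to_leaf := by revert j; decide

/-- `T` is the tree which corresponds to the behaviour, as `ε → +0`, of the upper half plane with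
the four marked points `z₁ = 1`, `z₂ = ∞`, `z₃ = 0`, `z₄ = z ε ∈ (0, 1)`. -/
inductive IsDegenerationTree (z : ℝ → ℝ) : RibbonTree 4 → Prop
  /-- `z₄` collides with `z₃`: the vertices `v₃`, `v₄` are attached to one interior vertex and
  `v₁`, `v₂` to the other one. -/
  | collision_z₃ : Tendsto z (𝓝[>] 0) (𝓝 0) → IsDegenerationTree z (twoNodeTree 0)
  /-- `z₄` collides with `z₁`: the vertices `v₄`, `v₁` are attached to one interior vertex and
  `v₂`, `v₃` to the other one. -/
  | collision_z₁ : Tendsto z (𝓝[>] 0) (𝓝 1) → IsDegenerationTree z (twoNodeTree 1)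
  /-- There is no collision: `z₄` stays away from `z₃` and `z₁`, and the disk does not break. -/
  | no_collision : (∃ δ > 0, ∀ᶠ ε in 𝓝[>] (0 : ℝ), z ε ∈ Icc δ (1 - δ)) →
      IsDegenerationTree z corolla

/-! Changing ε only scales the picture vertically, so the abscissas `p i` and the slopes `a i`
decide everything. The slopes cannot decrease all the way round the cycle, and this forces a
dichotomy (`AffineQuad.separated_or_aligned`): either two consecutive vertices lie strictly to the
left of the other two, or two opposite vertices share a vertical that separates the remaining two.

The behaviour of `z₄` follows from a length–area argument, without the Schwarz–Christoffel integral
and without extending the inverse map to the boundary. A Möbius map followed by `log` sends the half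
plane injectively into a rectangle of area π·(-log η), where η is `z₄` or `1 - z₄`, and there the
arcs belonging to two opposite sides are at distance at least log((1+η²)/(2η)). A family of segments
of length at most ℓ and Jacobian at least j joining these sides in the quadrilateral therefore gives
j·log((1+η²)/(2η))² ≤ ℓ²·π·(-log η). In the separated case the vertical segments over a fixed
interval have both ℓ and j of order ε, so η tends to 1 (`AffineQuad.tendsto_of_isSeparated`). In the
aligned case an ε-wide family near the common vertical has ℓ² and j both of order ε², so η stays
away from 0. This works for both pairs of opposite sides, hence there is no collision
(`AffineQuad.bounded_of_isAligned`).

On the side of gradient trees all flows are scalar linear equations. If `p i` is a minimum of `f (i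
+ 1) - f i`, a flow line coming from `p i` at time -∞ is constant, so the adjacent interior vertex
is pinned at `p i`; a maximum imposes nothing. A ribbon tree with four leaves is the corolla or some
`twoNodeTree i` (`RibbonTree.classification`). In each case of the dichotomy the pinned values and
the direction of the flow leave exactly one shape, and on it the positions and the length of the
interior edge are determined. -/

/-! ### Holomorphic inverses and the length–area inequality -/

/-- The inverse of an injective holomorphic function is holomorphic. -/
theorem differentiableOn_invFunOn_of_injOn {U : Set ℂ} {w : ℂ → ℂ} (hU : IsOpen U)
    (hUc : IsPreconnected U) (hUn : U.Nontrivial) (hd : DifferentiableOn ℂ w U)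
    (hi : InjOn w U) :
    IsOpen (w '' U) ∧ DifferentiableOn ℂ (Function.invFunOn w U) (w '' U) := by
  have han : AnalyticOnNhd ℂ w U := hd.analyticOnNhd hU
  have hnc : ¬ ∃ c, ∀ z ∈ U, w z = c := by
    rintro ⟨c, hc⟩
    obtain ⟨a, ha, b, hb, hab⟩ := hUn
    exact hab (hi ha hb ((hc a ha).trans (hc b hb).symm))
  have hopen : ∀ s ⊆ U, IsOpen s → IsOpen (w '' s) :=
    (han.is_constant_or_isOpen hUc).resolve_left hnc
  have hg : ∀ z ∈ U, Function.invFunOn w U (w z) = z := fun z hz => hi.leftInvOn_invFunOn hz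
  have hcont : ∀ z ∈ U, ContinuousAt (Function.invFunOn w U) (w z) := by
    intro z hz
    rw [ContinuousAt, hg z hz]
    intro N hN
    obtain ⟨M, hMN, hM, hzM⟩ := mem_nhds_iff.1 (inter_mem hN (hU.mem_nhds hz))
    rw [mem_map]
    refine mem_of_superset ((hopen M (fun x hx => (hMN hx).2) hM).mem_nhds ⟨z, hzM, rfl⟩) ?_
    rintro _ ⟨x, hx, rfl⟩
    rw [mem_preimage, hg x (hMN hx).2]
    exact (hMN hx).1
  refine ⟨hopen U subset_rfl hU, ?_⟩
  rintro _ ⟨z, hz, rfl⟩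
  -- It is enough that the zeros of the derivative are isolated: the inverse is holomorphic off them
  -- and continuous at them, so these singularities are removable.
  have hz0 : ∀ᶠ x in 𝓝[≠] z, deriv w x ≠ 0 := by
    rcases (han.deriv z hz).eventually_eq_zero_or_eventually_ne_zero with h | h
    · exfalso
      have h0 : EqOn (deriv w) 0 U := han.deriv.eqOn_zero_of_preconnected_of_eventuallyEq_zero
        hUc hz h
      apply hnc
      obtain ⟨c, hc⟩ := hU.exists_is_const_of_deriv_eq_zero hUc hd h0
      exact ⟨c, hc⟩
    · exact h
  obtain ⟨N, hNsub, hN, hzN⟩ := mem_nhds_iff.1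
    (inter_mem (eventually_nhdsWithin_iff.1 hz0) (hU.mem_nhds hz))
  have hNU : N ⊆ U := fun x hx => (hNsub hx).2
  have hmem : w '' N ∈ 𝓝 (w z) := (hopen N hNU hN).mem_nhds ⟨z, hzN, rfl⟩
  have key : DifferentiableOn ℂ (Function.invFunOn w U) (w '' N) := by
    rw [← Complex.differentiableOn_compl_singleton_and_continuousAt_iff hmem]
    refine ⟨?_, hcont z hz⟩
    rintro _ ⟨⟨x, hx, rfl⟩, hne⟩
    have hxz : x ≠ z := fun h => hne (by rw [h]; rfl)
    have hder : HasDerivAt w (deriv w x) (Function.invFunOn w U (w x)) := by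
      rw [hg x (hNU hx)]
      exact (hd.differentiableAt (hU.mem_nhds (hNU hx))).hasDerivAt
    refine (HasDerivAt.of_local_left_inverse (hcont x (hNU hx)) hder ((hNsub hx).1 hxz)
      ?_).differentiableAt.differentiableWithinAt
    filter_upwards [(hopen U subset_rfl hU).mem_nhds ⟨x, hNU hx, rfl⟩]
    rintro _ ⟨y, hy, rfl⟩
    rw [hg y hy]
  exact (key.differentiableAt hmem).differentiableWithinAt

/-- The determinant of the real-linear map `(s, t) ↦ s u + t v` from `ℝ²` to `ℂ = ℝ²`. -/
theorem det_prod_re_im (u v : ℂ) :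
    ((Complex.reCLM.comp ((ContinuousLinearMap.fst ℝ ℝ ℝ).smulRight u +
        (ContinuousLinearMap.snd ℝ ℝ ℝ).smulRight v)).prod
      (Complex.imCLM.comp ((ContinuousLinearMap.fst ℝ ℝ ℝ).smulRight u +
        (ContinuousLinearMap.snd ℝ ℝ ℝ).smulRight v))).det = u.re * v.im - u.im * v.re := by
  have h : ((Complex.reCLM.comp ((ContinuousLinearMap.fst ℝ ℝ ℝ).smulRight u +
        (ContinuousLinearMap.snd ℝ ℝ ℝ).smulRight v)).prod
      (Complex.imCLM.comp ((ContinuousLinearMap.fst ℝ ℝ ℝ).smulRight u +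
        (ContinuousLinearMap.snd ℝ ℝ ℝ).smulRight v))) =
      LinearMap.toContinuousLinearMap (Matrix.toLin (Module.Basis.finTwoProd ℝ)
        (Module.Basis.finTwoProd ℝ) !![u.re, v.re; u.im, v.im]) := by
    rw [Matrix.toLin_finTwoProd_toContinuousLinearMap]
    ext <;> simp
  rw [h]
  simp only [LinearMap.det_toContinuousLinearMap, LinearMap.det_toLin, Matrix.det_fin_two_of]
  ring

/-- The energy of a path of length at least `δ`, parametrised by a part of a unit interval. -/
theorem ofReal_sq_le_lintegral_sq {γ γ' : ℝ → ℂ} {δ : ℝ} (hδ : 0 ≤ δ)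
    (hγ : ∀ t ∈ Ioo (0 : ℝ) 1, HasDerivAt γ (γ' t) t) (hγ' : ContinuousOn γ' (Ioo 0 1))
    {a b : ℝ} (ha : a ∈ Ioo (0 : ℝ) 1) (hb : b ∈ Ioo (0 : ℝ) 1) (hab : δ ≤ ‖γ b - γ a‖) :
    ENNReal.ofReal (δ ^ 2) ≤ ∫⁻ t in Ioo (0 : ℝ) 1, ENNReal.ofReal (‖γ' t‖ ^ 2) := by
  wlog hle : a ≤ b generalizing a b
  · exact this hb ha (by rwa [norm_sub_rev]) (le_of_not_ge hle)
  have hsub : Icc a b ⊆ Ioo 0 1 := fun t ht => ⟨ha.1.trans_le ht.1, ht.2.trans_lt hb.2⟩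
  have hc : ContinuousOn γ' (Icc a b) := hγ'.mono hsub
  have hci : ContinuousOn (fun t => ‖γ' t‖) (Icc a b) := hc.norm
  have hFTC : ∫ t in a..b, γ' t = γ b - γ a := by
    refine intervalIntegral.integral_eq_sub_of_hasDerivAt (fun t ht => ?_) ?_
    · rw [uIcc_of_le hle] at ht
      exact hγ t (hsub ht)
    · exact hc.intervalIntegrable_of_Icc hle
  have h1 : δ ≤ ∫ t in a..b, ‖γ' t‖ := by
    refine hab.trans ?_
    rw [← hFTC]
    exact intervalIntegral.norm_integral_le_integral_norm hle
  have h2 : δ ^ 2 ≤ ∫ t in a..b, ‖γ' t‖ ^ 2 := by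
    -- Cauchy–Schwarz in linearised form: 2δx - δ² ≤ x² is integrated over an interval of length at
    -- most 1.
    have hm : ∫ t in a..b, (2 * δ * ‖γ' t‖ - δ ^ 2) ≤ ∫ t in a..b, ‖γ' t‖ ^ 2 := by
      refine intervalIntegral.integral_mono_on hle ?_ ?_ ?_
      · exact ((hci.const_mul _).sub continuousOn_const).intervalIntegrable_of_Icc hle
      · exact (hci.pow 2).intervalIntegrable_of_Icc hle
      · intro t _
        nlinarith [sq_nonneg (‖γ' t‖ - δ)]
    rw [intervalIntegral.integral_sub ((hci.const_mul _).intervalIntegrable_of_Icc hle)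
      (by simp), intervalIntegral.integral_const_mul] at hm
    simp only [intervalIntegral.integral_const, smul_eq_mul] at hm
    have : (b - a) * δ ^ 2 ≤ 1 * δ ^ 2 := by
      gcongr
      linarith [ha.1, hb.2]
    nlinarith
  calc ENNReal.ofReal (δ ^ 2) ≤ ENNReal.ofReal (∫ t in a..b, ‖γ' t‖ ^ 2) :=
        ENNReal.ofReal_le_ofReal h2
    _ = ∫⁻ t in Ioc a b, ENNReal.ofReal (‖γ' t‖ ^ 2) := by
        rw [intervalIntegral.integral_of_le hle, MeasureTheory.ofReal_integral_eq_lintegral_ofReal]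
        · exact (((hci.pow 2).integrableOn_Icc).mono_set Ioc_subset_Icc_self)
        · exact Filter.Eventually.of_forall fun t => by positivity
    _ ≤ _ := MeasureTheory.lintegral_mono_set (Ioc_subset_Icc_self.trans hsub)

/-- The length-area estimate: if an injective holomorphic function with values in a rectangle
stretches each segment of a ruled family to length at least `δ`, then the area of the rectangle
bounds `δ ^ 2`. -/
theorem length_area {U : Set ℂ} {k : ℂ → ℂ} (hU : IsOpen U) (hk : DifferentiableOn ℂ k U)
    (hki : InjOn k U) {a b c d : ℝ} (hab : a ≤ b) (hcd : c ≤ d)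
    (hkm : ∀ z ∈ U, ((k z).re ∈ Icc a b ∧ (k z).im ∈ Icc c d))
    {A₀ A₁ D₀ D₁ : ℂ} {j ℓ δ : ℝ} (hj : 0 < j) (hℓ : 0 < ℓ) (hδ : 0 ≤ δ)
    (hΨ : ∀ s ∈ Ioo (0 : ℝ) 1, ∀ t ∈ Ioo (0 : ℝ) 1, A₀ + s * A₁ + t * (D₀ + s * D₁) ∈ U)
    (hjac : ∀ s ∈ Ioo (0 : ℝ) 1, ∀ t ∈ Ioo (0 : ℝ) 1,
      j ≤ (A₁ + t * D₁).re * (D₀ + s * D₁).im - (A₁ + t * D₁).im * (D₀ + s * D₁).re)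
    (hlen : ∀ s ∈ Ioo (0 : ℝ) 1, ‖D₀ + s * D₁‖ ≤ ℓ)
    (hstretch : ∀ s ∈ Ioo (0 : ℝ) 1, ∃ t₁ ∈ Ioo (0 : ℝ) 1, ∃ t₂ ∈ Ioo (0 : ℝ) 1,
      δ ≤ ‖k (A₀ + s * A₁ + t₂ * (D₀ + s * D₁)) - k (A₀ + s * A₁ + t₁ * (D₀ + s * D₁))‖) :
    j * δ ^ 2 ≤ ℓ ^ 2 * ((b - a) * (d - c)) := by
  set Ψ : ℝ × ℝ → ℂ := fun q => A₀ + q.1 * A₁ + q.2 * (D₀ + q.1 * D₁) with hΨdef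
  set R : Set (ℝ × ℝ) := Ioo 0 1 ×ˢ Ioo 0 1 with hR
  have hRo : IsOpen R := isOpen_Ioo.prod isOpen_Ioo
  have hΨc : Continuous Ψ := by fun_prop
  have hΨU : ∀ q ∈ R, Ψ q ∈ U := fun q hq => hΨ q.1 hq.1 q.2 hq.2
  have hk' : ContinuousOn (fun q => deriv k (Ψ q)) R :=
    ((hk.analyticOnNhd hU).deriv.continuousOn).comp hΨc.continuousOn hΨU
  set u : ℝ × ℝ → ℂ := fun q => deriv k (Ψ q) * (A₁ + q.2 * D₁) with hu
  set v : ℝ × ℝ → ℂ := fun q => deriv k (Ψ q) * (D₀ + q.1 * D₁) with hv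
  have hkd : ∀ q ∈ R, HasDerivAt k (deriv k (Ψ q)) (Ψ q) := fun q hq =>
    (hk.differentiableAt (hU.mem_nhds (hΨU q hq))).hasDerivAt
  have hΨd : ∀ q, HasFDerivAt Ψ ((ContinuousLinearMap.fst ℝ ℝ ℝ).smulRight (A₁ + q.2 * D₁) +
        (ContinuousLinearMap.snd ℝ ℝ ℝ).smulRight (D₀ + q.1 * D₁)) q := by
    intro q
    have h1 : HasFDerivAt (fun q : ℝ × ℝ => (q.1 : ℂ))
        (Complex.ofRealCLM.comp (ContinuousLinearMap.fst ℝ ℝ ℝ)) q :=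
      (Complex.ofRealCLM.comp (ContinuousLinearMap.fst ℝ ℝ ℝ)).hasFDerivAt
    have h2 : HasFDerivAt (fun q : ℝ × ℝ => (q.2 : ℂ))
        (Complex.ofRealCLM.comp (ContinuousLinearMap.snd ℝ ℝ ℝ)) q :=
      (Complex.ofRealCLM.comp (ContinuousLinearMap.snd ℝ ℝ ℝ)).hasFDerivAt
    have h3 := ((h1.mul_const A₁).const_add A₀).add (h2.mul ((h1.mul_const D₁).const_add D₀))
    refine h3.congr_fderiv ?_
    ext <;> simp
  set G : ℝ × ℝ → (ℝ × ℝ →L[ℝ] ℂ) := fun q => (ContinuousLinearMap.fst ℝ ℝ ℝ).smulRight (u q) +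
        (ContinuousLinearMap.snd ℝ ℝ ℝ).smulRight (v q) with hG
  have hKd : ∀ q ∈ R, HasFDerivAt (k ∘ Ψ) (G q) q := by
    intro q hq
    have h := ((hkd q hq).hasFDerivAt.restrictScalars ℝ).comp q (hΨd q)
    refine h.congr_fderiv ?_
    ext <;> simp [hG, hu, hv] <;> ring
  set F : ℝ × ℝ → ℝ × ℝ := fun q => ((k (Ψ q)).re, (k (Ψ q)).im) with hF
  set F' : ℝ × ℝ → (ℝ × ℝ →L[ℝ] ℝ × ℝ) := fun q =>
    (Complex.reCLM.comp (G q)).prod (Complex.imCLM.comp (G q)) with hF'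
  have hFd : ∀ q ∈ R, HasFDerivWithinAt F (F' q) R q := by
    intro q hq
    exact ((Complex.reCLM.hasFDerivAt.comp q (hKd q hq)).prodMk
      (Complex.imCLM.hasFDerivAt.comp q (hKd q hq))).hasFDerivWithinAt
  have hFi : InjOn F R := by
    rintro ⟨s, t⟩ hq ⟨s', t'⟩ hq' h
    have h1 : k (Ψ (s, t)) = k (Ψ (s', t')) := by
      rw [hF] at h
      simp only [Prod.mk.injEq] at h
      exact Complex.ext h.1 h.2
    have h2 := hki (hΨU _ hq) (hΨU _ hq') h1
    -- The difference Ψ(s,t) - Ψ(s',t') equals (s-s')(A₁+tD₁) + (t-t')(D₀+s'D₁), so Cramer's rule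
    -- needs the Jacobian at the mixed point (s',t).
    have h3 := hjac s' hq'.1 t hq.2
    simp only [hΨdef] at h2
    have hre := congrArg Complex.re h2
    have him := congrArg Complex.im h2
    simp only [Complex.add_re, Complex.mul_re, Complex.ofReal_re, Complex.ofReal_im, Complex.add_im,
      Complex.mul_im, zero_mul, sub_zero, add_zero] at hre him h3
    have e1 : (s - s') * ((A₁.re + t * D₁.re) * (D₀.im + s' * D₁.im) -
        (A₁.im + t * D₁.im) * (D₀.re + s' * D₁.re)) = 0 := by
      linear_combination (D₀.im + s' * D₁.im) * hre - (D₀.re + s' * D₁.re) * him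
    have e2 : (t - t') * ((A₁.re + t * D₁.re) * (D₀.im + s' * D₁.im) -
        (A₁.im + t * D₁.im) * (D₀.re + s' * D₁.re)) = 0 := by
      linear_combination -(A₁.im + t * D₁.im) * hre + (A₁.re + t * D₁.re) * him
    have hne : ((A₁.re + t * D₁.re) * (D₀.im + s' * D₁.im) -
        (A₁.im + t * D₁.im) * (D₀.re + s' * D₁.re)) ≠ 0 := (hj.trans_le h3).ne'
    have hs := (mul_eq_zero.1 e1).resolve_right hne
    have ht := (mul_eq_zero.1 e2).resolve_right hne
    rw [Prod.mk.injEq]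
    exact ⟨by linarith, by linarith⟩
  -- Conformality: `k` multiplies areas by |k'|² and the velocity along a segment by |k'|. The
  -- unknown derivative therefore cancels in the comparison of area with energy.
  have hdet : ∀ q ∈ R, j / ℓ ^ 2 * ‖v q‖ ^ 2 ≤ |(F' q).det| := by
    intro q hq
    have e : (F' q).det = ‖deriv k (Ψ q)‖ ^ 2 * ((A₁ + q.2 * D₁).re * (D₀ + q.1 * D₁).im -
        (A₁ + q.2 * D₁).im * (D₀ + q.1 * D₁).re) := by
      rw [hF', hG]
      simp only
      rw [det_prod_re_im, hu, hv, ← Complex.normSq_eq_norm_sq, Complex.normSq_apply]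
      simp only [Complex.mul_re, Complex.mul_im]
      ring
    have h1 := hjac q.1 hq.1 q.2 hq.2
    rw [e, abs_of_nonneg (mul_nonneg (by positivity) (hj.le.trans h1)), hv]
    simp only
    rw [norm_mul, mul_pow]
    have h2 := hlen q.1 hq.1
    have h3 : ‖D₀ + q.1 * D₁‖ ^ 2 ≤ ℓ ^ 2 := by gcongr
    have h4 : j / ℓ ^ 2 * ‖D₀ + q.1 * D₁‖ ^ 2 ≤ j := by
      rw [div_mul_eq_mul_div, div_le_iff₀ (by positivity)]
      gcongr
    calc _ = ‖deriv k (Ψ q)‖ ^ 2 * (j / ℓ ^ 2 * ‖D₀ + q.1 * D₁‖ ^ 2) := by ring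
      _ ≤ _ := by gcongr; exact h4.trans h1
  have hvc : ContinuousOn v R := hk'.mul (by fun_prop)
  have hslice : ∀ s ∈ Ioo (0 : ℝ) 1, ENNReal.ofReal (δ ^ 2) ≤
      ∫⁻ t in Ioo (0 : ℝ) 1, ENNReal.ofReal (‖v (s, t)‖ ^ 2) := by
    intro s hs
    obtain ⟨t₁, ht₁, t₂, ht₂, h⟩ := hstretch s hs
    refine ofReal_sq_le_lintegral_sq (γ := fun t => k (Ψ (s, t))) hδ (fun t ht => ?_) ?_ ht₁ ht₂ h
    · have h1 : HasDerivAt (fun t : ℝ => Ψ (s, t)) (D₀ + s * D₁) t := by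
        have := ((Complex.ofRealCLM.hasDerivAt (x := t)).mul_const (D₀ + s * D₁)).const_add
          (A₀ + s * A₁)
        simpa [hΨdef] using this
      exact (hkd (s, t) ⟨hs, ht⟩).comp_of_eq t h1 rfl
    · exact hvc.comp (by fun_prop) (fun t ht => ⟨hs, ht⟩)
  have harea : ∫⁻ q in R, ENNReal.ofReal |(F' q).det| ≤
      ENNReal.ofReal ((b - a) * (d - c)) := by
    rw [MeasureTheory.lintegral_abs_det_fderiv_eq_addHaar_image MeasureTheory.volume
      hRo.measurableSet hFd hFi]
    calc _ ≤ MeasureTheory.volume (Icc a b ×ˢ Icc c d) := by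
          apply MeasureTheory.measure_mono
          rintro _ ⟨q, hq, rfl⟩
          exact hkm _ (hΨU q hq)
      _ = _ := by
          rw [MeasureTheory.Measure.volume_eq_prod, MeasureTheory.Measure.prod_prod,
            Real.volume_Icc, Real.volume_Icc, ENNReal.ofReal_mul (by linarith)]
  have hlow : ENNReal.ofReal (j / ℓ ^ 2 * δ ^ 2) ≤ ∫⁻ q in R, ENNReal.ofReal |(F' q).det| := by
    calc ENNReal.ofReal (j / ℓ ^ 2 * δ ^ 2)
        = ∫⁻ s in Ioo (0 : ℝ) 1, ENNReal.ofReal (j / ℓ ^ 2) * ENNReal.ofReal (δ ^ 2) := by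
          rw [MeasureTheory.setLIntegral_const, Real.volume_Ioo,
            ENNReal.ofReal_mul (by positivity)]
          simp
      _ ≤ ∫⁻ s in Ioo (0 : ℝ) 1, ENNReal.ofReal (j / ℓ ^ 2) *
            ∫⁻ t in Ioo (0 : ℝ) 1, ENNReal.ofReal (‖v (s, t)‖ ^ 2) := by
          refine MeasureTheory.setLIntegral_mono' measurableSet_Ioo fun s hs => ?_
          gcongr
          exact hslice s hs
      _ = ∫⁻ s in Ioo (0 : ℝ) 1, ∫⁻ t in Ioo (0 : ℝ) 1,
            ENNReal.ofReal (j / ℓ ^ 2) * ENNReal.ofReal (‖v (s, t)‖ ^ 2) := by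
          simp_rw [MeasureTheory.lintegral_const_mul' _ _ ENNReal.ofReal_ne_top]
      _ = ∫⁻ q in R, ENNReal.ofReal (j / ℓ ^ 2) * ENNReal.ofReal (‖v q‖ ^ 2) := by
          have hm : AEMeasurable (fun q => ENNReal.ofReal (j / ℓ ^ 2) *
              ENNReal.ofReal (‖v q‖ ^ 2)) (MeasureTheory.volume.restrict R) := by
            refine AEMeasurable.const_mul ?_ _
            exact ((hvc.norm.pow 2).aemeasurable hRo.measurableSet).ennreal_ofReal
          rw [MeasureTheory.Measure.volume_eq_prod, hR,
            ← MeasureTheory.Measure.prod_restrict] at hm ⊢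
          rw [MeasureTheory.lintegral_prod _ hm]
      _ ≤ _ := by
          refine MeasureTheory.setLIntegral_mono' hRo.measurableSet fun q hq => ?_
          rw [← ENNReal.ofReal_mul (by positivity)]
          exact ENNReal.ofReal_le_ofReal (hdet q hq)
  have hfin := hlow.trans harea
  rw [ENNReal.ofReal_le_ofReal_iff (mul_nonneg (by linarith) (by linarith)),
    div_mul_eq_mul_div, div_le_iff₀ (by positivity)] at hfin
  linarith

/-! ### Mapping the half plane into a rectangle -/

/-- The Möbius transformation of the upper half plane onto the disk with diameter `(η, 1)`. -/
noncomputable def diskMap (c η : ℝ) (z : ℂ) : ℂ := (z - c + η * Complex.I) / (z - c + Complex.I)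

theorem diskMap_den_ne_zero (c : ℝ) {z : ℂ} (hz : 0 ≤ z.im) : z - c + Complex.I ≠ 0 := by
  intro h
  have := congrArg Complex.im h
  simp at this
  linarith

theorem normSq_diskMap (c η : ℝ) (z : ℂ) : Complex.normSq (diskMap c η z) =
    ((z.re - c) ^ 2 + (z.im + η) ^ 2) / ((z.re - c) ^ 2 + (z.im + 1) ^ 2) := by
  rw [diskMap, Complex.normSq_div, Complex.normSq_apply, Complex.normSq_apply]
  simp
  ring

theorem diskMap_re_pos (c : ℝ) {η : ℝ} (hη : 0 < η) {z : ℂ} (hz : 0 ≤ z.im) :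
    0 < (diskMap c η z).re := by
  have e : (diskMap c η z).re = ((z.re - c) ^ 2 + (z.im + η) * (z.im + 1)) /
      ((z.re - c) ^ 2 + (z.im + 1) ^ 2) := by
    rw [diskMap, Complex.div_re, Complex.normSq_apply]
    simp
    rw [← add_div]
    congr 1 <;> ring
  rw [e]
  positivity

theorem re_log_diskMap (c η : ℝ) (z : ℂ) : (Complex.log (diskMap c η z)).re =
    Real.log (((z.re - c) ^ 2 + (z.im + η) ^ 2) / ((z.re - c) ^ 2 + (z.im + 1) ^ 2)) / 2 := by
  rw [Complex.log_re, ← normSq_diskMap, Complex.normSq_eq_norm_sq, Real.log_pow]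
  push_cast
  ring

/-- The disk with diameter (η, 1) lies in the annulus between the radii η and 1 and in the right
half plane. This supplies the area π·(-log η) in the length–area inequality. -/
theorem log_diskMap_mem {c η : ℝ} (hη : 0 < η) (hη1 : η < 1) {z : ℂ} (hz : 0 ≤ z.im) :
    (Complex.log (diskMap c η z)).re ∈ Icc (Real.log η) 0 ∧
      (Complex.log (diskMap c η z)).im ∈ Icc (-(Real.pi / 2)) (Real.pi / 2) := by
  have hden : 0 < (z.re - c) ^ 2 + (z.im + 1) ^ 2 := by positivity
  refine ⟨⟨?_, ?_⟩, ?_⟩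
  · rw [re_log_diskMap]
    have h : Real.log (η ^ 2) ≤
        Real.log (((z.re - c) ^ 2 + (z.im + η) ^ 2) / ((z.re - c) ^ 2 + (z.im + 1) ^ 2)) := by
      apply Real.log_le_log (by positivity)
      rw [le_div_iff₀ hden]
      have h1 : η * (z.im + 1) ≤ z.im + η := by nlinarith
      have h2 : (η * (z.im + 1)) ^ 2 ≤ (z.im + η) ^ 2 := by gcongr
      have h3 : η ^ 2 * (z.re - c) ^ 2 ≤ 1 * (z.re - c) ^ 2 := by
        gcongr
        nlinarith
      nlinarith
    rw [Real.log_pow] at h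
    push_cast at h
    linarith
  · rw [re_log_diskMap]
    have h : Real.log (((z.re - c) ^ 2 + (z.im + η) ^ 2) /
        ((z.re - c) ^ 2 + (z.im + 1) ^ 2)) ≤ 0 := by
      apply Real.log_nonpos (by positivity)
      rw [div_le_one hden]
      gcongr
    linarith
  · rw [Complex.log_im]
    exact abs_le.1 (Complex.abs_arg_lt_pi_div_two_iff.2 (.inl (diskMap_re_pos c hη hz))).le

theorem differentiableAt_log_diskMap (c : ℝ) {η : ℝ} (hη : 0 < η) {z : ℂ} (hz : 0 ≤ z.im) :
    DifferentiableAt ℂ (fun z => Complex.log (diskMap c η z)) z := by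
  refine DifferentiableAt.clog ?_ (.inl (diskMap_re_pos c hη hz))
  unfold diskMap
  have := diskMap_den_ne_zero c hz
  fun_prop (disch := assumption)

theorem injOn_log_diskMap (c : ℝ) {η : ℝ} (hη : 0 < η) (hη1 : η < 1) :
    InjOn (fun z => Complex.log (diskMap c η z)) {z | 0 < z.im} := by
  intro z hz z' hz' h
  have hne : ∀ z : ℂ, 0 < z.im → diskMap c η z ≠ 0 := fun z hz h => by
    simpa [h] using diskMap_re_pos c hη (le_of_lt hz)
  have h1 : diskMap c η z = diskMap c η z' := by
    rw [← Complex.exp_log (hne z hz), ← Complex.exp_log (hne z' hz')]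
    exact congrArg _ h
  rw [diskMap, diskMap, div_eq_div_iff (diskMap_den_ne_zero c (le_of_lt hz))
    (diskMap_den_ne_zero c (le_of_lt hz'))] at h1
  have h2 : (z - z') * ((1 - η : ℝ) * Complex.I) = 0 := by
    push_cast
    linear_combination h1
  have h3 : ((1 - η : ℝ) * Complex.I : ℂ) ≠ 0 :=
    mul_ne_zero (by exact_mod_cast (sub_pos.2 hη1).ne') Complex.I_ne_zero
  exact sub_eq_zero.1 ((mul_eq_zero.1 h2).resolve_right h3)

/-- Real points near `c` and far from `c` are separated by `log (diskMap c η)`. -/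
theorem log_diskMap_separated {c η t t' : ℝ} (hη : 0 < η) (hη1 : η ≤ 1) (ht : |t - c| ≤ η)
    (ht' : 1 ≤ |t' - c|) : Real.log ((1 + η ^ 2) / (2 * η)) ≤
      (Complex.log (diskMap c η t')).re - (Complex.log (diskMap c η t)).re := by
  -- The squared modulus of `diskMap` is at most 2η²/(1+η²) on the near points and at least (1+η²)/2
  -- on the far ones; the bound is half the logarithm of the quotient.
  have e : Real.log ((1 + η ^ 2) / (2 * η)) =
      Real.log ((1 + η ^ 2) / 2) / 2 - Real.log (2 * η ^ 2 / (1 + η ^ 2)) / 2 := by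
    rw [← sub_div, ← Real.log_div (by positivity) (by positivity), eq_div_iff two_ne_zero,
      mul_comm, ← Nat.cast_two, ← Real.log_pow]
    congr 1
    field_simp
  have h1 : (t - c) ^ 2 ≤ η ^ 2 := sq_le_sq' (by linarith [abs_le.1 ht]) (abs_le.1 ht).2
  have h2 : 1 ≤ (t' - c) ^ 2 := by
    rw [← sq_abs]
    nlinarith
  have hη2 : η ^ 2 ≤ 1 := pow_le_one₀ hη.le hη1
  have h3 : Real.log (((t - c) ^ 2 + η ^ 2) / ((t - c) ^ 2 + 1)) ≤
      Real.log (2 * η ^ 2 / (1 + η ^ 2)) := by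
    apply Real.log_le_log (by positivity)
    rw [div_le_div_iff₀ (by positivity) (by positivity)]
    nlinarith [mul_nonneg (sub_nonneg.2 h1) (sub_nonneg.2 hη2)]
  have h4 : Real.log ((1 + η ^ 2) / 2) ≤ Real.log (((t' - c) ^ 2 + η ^ 2) / ((t' - c) ^ 2 + 1)) := by
    apply Real.log_le_log (by positivity)
    rw [div_le_div_iff₀ (by positivity) (by positivity)]
    nlinarith [mul_nonneg (sub_nonneg.2 h2) (sub_nonneg.2 hη2)]
  rw [e, re_log_diskMap, re_log_diskMap]
  simp only [Complex.ofReal_re, Complex.ofReal_im, zero_add, one_pow]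
  linarith

/-! ### Boundary correspondence and moduli of opposite arcs -/

/-- The open arc of the real line between the marked points `z_{i - 1}` and `z_i`. -/
def markedArc (ξ : ℝ) : Fin 4 → Set ℝ := ![Ioo ξ 1, Ioi 1, Iio 0, Ioo 0 ξ]

/-- A substitute for the boundary extension of the inverse. The preimages `G t` cannot escape to
infinity, where `w` tends to a vertex, since every vertex lies on two of the lines and `a` avoids
all but one. They therefore cluster at some z with `w z = a`. Such a z is real because interior
points go to the interior, and the arc containing it is read off from the line containing `a`. -/
theorem IsSchwarzChristoffel.exists_mapClusterPt {L : Fin 4 → Set ℂ} {x : Fin 4 → ℂ} {ξ : ℝ}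
    {w : ℂ → ℂ} (hw : IsSchwarzChristoffel L x ξ w) (hL : ∀ i, x i ∈ L i ∧ x i ∈ L (i + 1))
    {G : ℝ → ℂ} {l : Filter ℝ} [l.NeBot] (hG : ∀ᶠ t in l, 0 < (G t).im) {a : ℂ}
    (hlim : Tendsto (fun t => w (G t)) l (𝓝 a))
    (haQ : a ∉ interior (convexHull ℝ (Set.range x))) {i : Fin 4} (hai : ∀ m ≠ i, a ∉ L m) :
    ∃ z ∈ markedArc ξ i, MapClusterPt (z : ℂ) l G := by
  have hvert : ∀ k, a ≠ x k := by
    intro k h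
    by_cases hk : k = i
    · refine hai (k + 1) ?_ (h ▸ (hL k).2)
      rw [← hk]
      simp
    · exact hai k hk (h ▸ (hL k).1)
  have hlim' : Tendsto w (map G l) (𝓝 a) := tendsto_map'_iff.2 hlim
  have hcl : map G l ≤ 𝓟 {z : ℂ | 0 ≤ z.im} := by
    rw [le_principal_iff]
    exact hG.mono fun t ht => le_of_lt ht
  have hdisj : Disjoint (map G l) (cocompact ℂ) := by
    rw [disjoint_iff, ← not_neBot]
    intro hne
    exact hvert 1 (tendsto_nhds_unique (hlim'.mono_left inf_le_left)
      (hw.map_z₂.mono_left (le_inf inf_le_right (inf_le_left.trans hcl))))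
  obtain ⟨K, hK, hKc⟩ := (disjoint_cocompact_right _).1 hdisj
  obtain ⟨z, -, hz⟩ := hKc.exists_mapClusterPt (le_principal_iff.2 hK)
  have hz0 : 0 ≤ z.im := (isClosed_le continuous_const Complex.continuous_im).mem_of_mapClusterPt
    hz (hG.mono fun t ht => le_of_lt ht)
  have hne : (𝓝 z ⊓ map G l).NeBot := hz
  have hwz : w z = a := tendsto_nhds_unique
    ((hw.continuousOn z hz0).mono_left (le_inf inf_le_left (inf_le_right.trans hcl)))
    (hlim'.mono_left inf_le_right)
  have him : z.im = 0 := by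
    refine le_antisymm (not_lt.1 fun h => haQ ?_) hz0
    rw [← hw.image_eq, ← hwz]
    exact ⟨z, h, rfl⟩
  obtain ⟨t, rfl⟩ : ∃ t : ℝ, z = t := ⟨z.re, Complex.ext rfl (by simpa using him)⟩
  refine ⟨t, ?_, hz⟩
  have h1 : t ≠ 1 := by
    rintro rfl
    exact hvert 0 (by rw [← hwz, ← hw.map_z₁]; simp)
  have h0 : t ≠ 0 := by
    rintro rfl
    exact hvert 2 (by rw [← hwz, ← hw.map_z₃]; simp)
  have hx : t ≠ ξ := by
    rintro rfl
    exact hvert 3 (by rw [← hwz, ← hw.map_z₄])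
  have key : ∀ m, w t ∈ L m → i = m := by
    intro m hm
    by_contra h
    exact hai m (Ne.symm h) (hwz ▸ hm)
  rcases lt_or_gt_of_ne h0 with h | h
  · obtain rfl := key 2 (hw.arc₃ t h)
    exact h
  rcases lt_or_gt_of_ne hx with h' | h'
  · obtain rfl := key 3 (hw.arc₄ t h h')
    exact ⟨h, h'⟩
  rcases lt_or_gt_of_ne h1 with h'' | h''
  · obtain rfl := key 0 (hw.arc₁ t h' h'')
    exact ⟨h', h''⟩
  · obtain rfl := key 1 (hw.arc₂ t h'')
    exact h''

/-- The centre of the arcs `markedArc ξ i` and `markedArc ξ (i + 2)`: one of them lies in the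
interval of radius `arcRadius ξ i` about it, the other one outside the interval of radius `1`. -/
def arcCentre (i : Fin 4) : ℝ := if i = 0 ∨ i = 2 then 1 else 0

/-- See `arcCentre`. -/
def arcRadius (ξ : ℝ) (i : Fin 4) : ℝ := if i = 0 ∨ i = 2 then 1 - ξ else ξ

/-- Centred at 1 with radius 1 - ξ, the arc (ξ, 1) is near and the arc (-∞, 0) is far; centred at 0
with radius ξ, the arc (0, ξ) is near and (1, ∞) is far. Passing from i to i + 2 only exchanges the
two roles. -/
theorem log_diskMap_markedArc {ξ : ℝ} (hξ : ξ ∈ Ioo (0 : ℝ) 1) (i : Fin 4) {t t' : ℝ}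
    (ht : t ∈ markedArc ξ i) (ht' : t' ∈ markedArc ξ (i + 2)) :
    Real.log ((1 + arcRadius ξ i ^ 2) / (2 * arcRadius ξ i)) ≤
      ‖Complex.log (diskMap (arcCentre i) (arcRadius ξ i) t') -
        Complex.log (diskMap (arcCentre i) (arcRadius ξ i) t)‖ := by
  obtain ⟨h0, h1⟩ := hξ
  have hη : 0 < arcRadius ξ i ∧ arcRadius ξ i ≤ 1 := by
    unfold arcRadius
    split_ifs <;> constructor <;> linarith
  have key : ∀ t t' : ℝ, |t - arcCentre i| ≤ arcRadius ξ i → 1 ≤ |t' - arcCentre i| →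
      Real.log ((1 + arcRadius ξ i ^ 2) / (2 * arcRadius ξ i)) ≤
      ‖Complex.log (diskMap (arcCentre i) (arcRadius ξ i) t') -
        Complex.log (diskMap (arcCentre i) (arcRadius ξ i) t)‖ := by
    intro t t' h h'
    refine (log_diskMap_separated hη.1 hη.2 h h').trans ?_
    rw [← Complex.sub_re]
    exact Complex.re_le_norm _
  have key' : (|t - arcCentre i| ≤ arcRadius ξ i ∧ 1 ≤ |t' - arcCentre i|) ∨
      (|t' - arcCentre i| ≤ arcRadius ξ i ∧ 1 ≤ |t - arcCentre i|) := by
    fin_cases i <;> simp [markedArc, arcCentre, arcRadius] at ht ht' ⊢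
    · left
      exact ⟨abs_le.2 ⟨by linarith, by linarith⟩, le_abs.2 (.inr (by linarith))⟩
    · right
      exact ⟨abs_le.2 ⟨by linarith, by linarith⟩, le_abs.2 (.inl (by linarith))⟩
    · right
      exact ⟨abs_le.2 ⟨by linarith, by linarith⟩, le_abs.2 (.inr (by linarith))⟩
    · left
      exact ⟨abs_le.2 ⟨by linarith, by linarith⟩, le_abs.2 (.inl (by linarith))⟩
  rcases key' with h | h
  · exact key t t' h.1 h.2
  · rw [norm_sub_rev]
    exact key t' t h.1 h.2

/-- The length-area estimate for a ruled family of segments in the polygon that connect the sides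
on `L i` and `L (i + 2)`. -/
theorem IsSchwarzChristoffel.length_area {L : Fin 4 → Set ℂ} {x : Fin 4 → ℂ} {ξ : ℝ} {w : ℂ → ℂ}
    (hw : IsSchwarzChristoffel L x ξ w) (hL : ∀ i, x i ∈ L i ∧ x i ∈ L (i + 1))
    (hξ : ξ ∈ Ioo (0 : ℝ) 1) (i : Fin 4) {A₀ A₁ D₀ D₁ : ℂ} {j ℓ : ℝ} (hj : 0 < j) (hℓ : 0 < ℓ)
    (hΨ : ∀ s ∈ Ioo (0 : ℝ) 1, ∀ t ∈ Ioo (0 : ℝ) 1,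
      A₀ + s * A₁ + t * (D₀ + s * D₁) ∈ interior (convexHull ℝ (Set.range x)))
    (hA : ∀ s ∈ Ioo (0 : ℝ) 1, A₀ + s * A₁ ∉ interior (convexHull ℝ (Set.range x)) ∧
      ∀ m ≠ i, A₀ + s * A₁ ∉ L m)
    (hB : ∀ s ∈ Ioo (0 : ℝ) 1,
      A₀ + s * A₁ + (D₀ + s * D₁) ∉ interior (convexHull ℝ (Set.range x)) ∧
      ∀ m ≠ i + 2, A₀ + s * A₁ + (D₀ + s * D₁) ∉ L m)
    (hjac : ∀ s ∈ Ioo (0 : ℝ) 1, ∀ t ∈ Ioo (0 : ℝ) 1,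
      j ≤ (A₁ + t * D₁).re * (D₀ + s * D₁).im - (A₁ + t * D₁).im * (D₀ + s * D₁).re)
    (hlen : ∀ s ∈ Ioo (0 : ℝ) 1, ‖D₀ + s * D₁‖ ≤ ℓ) :
    j * Real.log ((1 + arcRadius ξ i ^ 2) / (2 * arcRadius ξ i)) ^ 2 ≤
      ℓ ^ 2 * (-Real.log (arcRadius ξ i) * Real.pi) := by
  set η := arcRadius ξ i with hηdef
  set c := arcCentre i
  have hη : 0 < η ∧ η < 1 := by
    rw [hηdef, arcRadius]
    split_ifs <;> constructor <;> linarith [hξ.1, hξ.2]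
  set H : Set ℂ := {z | 0 < z.im} with hH
  have hHo : IsOpen H := isOpen_lt continuous_const Complex.continuous_im
  have hHc : IsPreconnected H := by
    have : Convex ℝ H := convex_halfSpace_im_gt 0
    exact this.isPreconnected
  have hHn : H.Nontrivial := ⟨Complex.I, by simp [hH], 2 * Complex.I, by simp [hH], by
    intro h
    simpa using congrArg Complex.im h⟩
  obtain ⟨-, hgd⟩ := differentiableOn_invFunOn_of_injOn hHo hHc hHn hw.differentiableOn hw.injOn
  set g := Function.invFunOn w H
  rw [hw.image_eq] at hgd
  set U := interior (convexHull ℝ (Set.range x)) with hU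
  have hgH : ∀ q ∈ U, g q ∈ H ∧ w (g q) = q := by
    intro q hq
    rw [hU, ← hw.image_eq] at hq
    exact ⟨Function.invFunOn_mem hq, Function.invFunOn_eq hq⟩
  set h : ℂ → ℂ := fun z => Complex.log (diskMap c η z) with hh
  have hkd : DifferentiableOn ℂ (h ∘ g) U := by
    intro q hq
    exact (differentiableAt_log_diskMap c hη.1 (le_of_lt (hgH q hq).1)).comp_differentiableWithinAt
      q (hgd q hq)
  have hki : InjOn (h ∘ g) U := by
    intro q hq q' hq' e
    have := injOn_log_diskMap c hη.1 hη.2 (hgH q hq).1 (hgH q' hq').1 e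
    rw [← (hgH q hq).2, ← (hgH q' hq').2, this]
  have hDpos : 0 < Real.log ((1 + η ^ 2) / (2 * η)) := by
    apply Real.log_pos
    rw [lt_div_iff₀ (by linarith [hη.1])]
    nlinarith [sq_pos_of_pos (sub_pos.2 hη.2)]
  -- The arcs are approached only along cluster points, so segments are seen to be stretched to
  -- every length strictly below the distance of the arcs; that distance itself is reached by a
  -- limit in δ.
  have main : ∀ δ ∈ Ioo 0 (Real.log ((1 + η ^ 2) / (2 * η))),
      j * δ ^ 2 ≤ ℓ ^ 2 * (-Real.log η * Real.pi) := by
    intro δ hδ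
    have := _root_.length_area isOpen_interior hkd hki (a := Real.log η) (b := 0)
      (c := -(Real.pi / 2)) (d := Real.pi / 2) (Real.log_nonpos hη.1.le hη.2.le)
      (by linarith [Real.pi_pos])
      (fun z hz => log_diskMap_mem hη.1 hη.2 (le_of_lt (hgH z hz).1)) hj hℓ hδ.1.le hΨ hjac hlen ?_
    · calc _ ≤ _ := this
        _ = _ := by ring
    intro s hs
    have hcont : Continuous fun t : ℝ => A₀ + s * A₁ + t * (D₀ + s * D₁) := by fun_prop
    have hev0 : ∀ᶠ t in 𝓝[>] (0 : ℝ), t ∈ Ioo (0 : ℝ) 1 := Ioo_mem_nhdsGT one_pos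
    have hev1 : ∀ᶠ t in 𝓝[<] (1 : ℝ), t ∈ Ioo (0 : ℝ) 1 := Ioo_mem_nhdsLT one_pos
    have hGim : ∀ t ∈ Ioo (0 : ℝ) 1, 0 < (g (A₀ + s * A₁ + t * (D₀ + s * D₁))).im :=
      fun t ht => (hgH _ (hΨ s hs t ht)).1
    have hlim : ∀ {l : Filter ℝ} {r : ℝ}, l ≤ 𝓝 r → (∀ᶠ t in l, t ∈ Ioo (0 : ℝ) 1) →
        Tendsto (fun t : ℝ => w (g (A₀ + s * A₁ + t * (D₀ + s * D₁)))) l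
          (𝓝 (A₀ + s * A₁ + r * (D₀ + s * D₁))) := by
      intro l r hl hev
      refine Tendsto.congr' ?_ ((hcont.tendsto r).mono_left hl)
      filter_upwards [hev] with t ht
      exact (hgH _ (hΨ s hs t ht)).2.symm
    have hl0 := hlim nhdsWithin_le_nhds hev0
    have hl1 := hlim nhdsWithin_le_nhds hev1
    simp only [Complex.ofReal_zero, zero_mul, add_zero, Complex.ofReal_one, one_mul] at hl0 hl1
    obtain ⟨z₁, hz₁, hc₁⟩ := hw.exists_mapClusterPt hL (hev0.mono hGim) hl0 (hA s hs).1 (hA s hs).2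
    obtain ⟨z₂, hz₂, hc₂⟩ := hw.exists_mapClusterPt hL (hev1.mono hGim) hl1 (hB s hs).1 (hB s hs).2
    have hcat : ∀ z : ℝ, ContinuousAt h z := fun z =>
      (differentiableAt_log_diskMap c hη.1 (by simp)).continuousAt
    have hD := log_diskMap_markedArc hξ i hz₁ hz₂
    have hsmall : 0 < (Real.log ((1 + η ^ 2) / (2 * η)) - δ) / 2 := by linarith [hδ.2]
    have hfreq : ∀ {l : Filter ℝ} {z : ℝ}, (∀ᶠ t in l, t ∈ Ioo (0 : ℝ) 1) →
        MapClusterPt (z : ℂ) l (fun t : ℝ => g (A₀ + s * A₁ + t * (D₀ + s * D₁))) →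
        ∃ t ∈ Ioo (0 : ℝ) 1, ‖h (g (A₀ + s * A₁ + t * (D₀ + s * D₁))) - h z‖ <
          (Real.log ((1 + η ^ 2) / (2 * η)) - δ) / 2 := by
      intro l z hev hc
      have := (hc.continuousAt_comp (hcat z)).frequently (Metric.ball_mem_nhds _ hsmall)
      obtain ⟨t, ht, ht'⟩ := (this.and_eventually hev).exists
      exact ⟨t, ht', by simpa [Metric.mem_ball, dist_eq_norm] using ht⟩
    obtain ⟨t₁, ht₁, hb₁⟩ := hfreq hev0 hc₁
    obtain ⟨t₂, ht₂, hb₂⟩ := hfreq hev1 hc₂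
    refine ⟨t₁, ht₁, t₂, ht₂, ?_⟩
    simp only [Function.comp_apply]
    set q₁ := h (g (A₀ + s * A₁ + t₁ * (D₀ + s * D₁)))
    set q₂ := h (g (A₀ + s * A₁ + t₂ * (D₀ + s * D₁)))
    have htri : ‖h z₂ - h z₁‖ ≤ ‖q₂ - q₁‖ + ‖q₂ - h z₂‖ + ‖q₁ - h z₁‖ := by
      calc ‖h z₂ - h z₁‖ = ‖(q₂ - q₁) - (q₂ - h z₂) + (q₁ - h z₁)‖ := by congr 1; ring
        _ ≤ ‖(q₂ - q₁) - (q₂ - h z₂)‖ + ‖q₁ - h z₁‖ := norm_add_le _ _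
        _ ≤ _ := by gcongr; exact norm_sub_le _ _
    have hD' : Real.log ((1 + η ^ 2) / (2 * η)) ≤ ‖h z₂ - h z₁‖ := hD
    linarith
  have hcontδ : Continuous fun δ : ℝ => j * δ ^ 2 := by fun_prop
  refine le_of_tendsto ((hcontδ.tendsto _).mono_left
    (nhdsWithin_le_nhds (s := Iio (Real.log ((1 + η ^ 2) / (2 * η)))))) ?_
  filter_upwards [Ioo_mem_nhdsLT hDpos] with δ hδ
  exact main δ hδ

/-! ### Convex quadrilaterals -/

/-- The affine function that vanishes on the line through `x i` and `x (i + 1)` and is positive on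
its left. -/
def sideForm (x : Fin 4 → ℂ) (i : Fin 4) (z : ℂ) : ℝ :=
  (x (i + 1) - x i).re * (z - x i).im - (x (i + 1) - x i).im * (z - x i).re

theorem sideForm_combo (x : Fin 4 → ℂ) (i : Fin 4) {a b : ℝ} (hab : a + b = 1) (u v : ℂ) :
    sideForm x i (a • u + b • v) = a * sideForm x i u + b * sideForm x i v := by
  obtain rfl : b = 1 - a := by linarith
  simp only [sideForm, Complex.sub_re, Complex.sub_im, Complex.add_re, Complex.add_im,
    Complex.real_smul, Complex.re_ofReal_mul, Complex.im_ofReal_mul]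
  ring

theorem continuous_sideForm (x : Fin 4 → ℂ) (i : Fin 4) : Continuous (sideForm x i) := by
  unfold sideForm
  fun_prop

theorem sideForm_vertex (x : Fin 4 → ℂ) (i : Fin 4) :
    sideForm x i (x i) = 0 ∧ sideForm x i (x (i + 1)) = 0 := by
  constructor
  · simp [sideForm]
  · simp [sideForm]
    ring

theorem IsConvexCCW.sideForm_nonneg {x : Fin 4 → ℂ} (hx : IsConvexCCW x) (i k : Fin 4) :
    0 ≤ sideForm x i (x k) := by
  by_cases h : k = i
  · rw [h, (sideForm_vertex x i).1]
  by_cases h' : k = i + 1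
  · rw [h', (sideForm_vertex x i).2]
  exact (hx i k h h').le

/-- A point lies in a positively oriented triangle when it is on the left of its sides. -/
theorem mem_convexHull_triangle {S : Set ℂ} {u v w z : ℂ} (hu : u ∈ S) (hv : v ∈ S) (hw : w ∈ S)
    (hT : 0 < (v - u).re * (w - u).im - (v - u).im * (w - u).re)
    (h1 : 0 ≤ (v - u).re * (z - u).im - (v - u).im * (z - u).re)
    (h2 : 0 ≤ (w - v).re * (z - v).im - (w - v).im * (z - v).re)
    (h3 : 0 ≤ (u - w).re * (z - w).im - (u - w).im * (z - w).re) : z ∈ convexHull ℝ S := by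
  set T := (v - u).re * (w - u).im - (v - u).im * (w - u).re with hTdef
  set r := (v - u).re * (z - u).im - (v - u).im * (z - u).re with hr
  set s := (w - v).re * (z - v).im - (w - v).im * (z - v).re with hs
  set t := (u - w).re * (z - w).im - (u - w).im * (z - w).re with ht
  have hsum : s + t + r = T := by
    rw [hr, hs, ht, hTdef]
    simp only [Complex.sub_re, Complex.sub_im]
    ring
  -- The barycentric coordinates are the areas of the triangles spanned by z and the opposite sides,
  -- divided by the total area.
  have hz : z = (s / T) • u + (t / T) • v + (r / T) • w := by
    have hre : T * z.re = s * u.re + t * v.re + r * w.re := by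
      rw [hr, hs, ht, hTdef]
      simp only [Complex.sub_re, Complex.sub_im]
      ring
    have him : T * z.im = s * u.im + t * v.im + r * w.im := by
      rw [hr, hs, ht, hTdef]
      simp only [Complex.sub_re, Complex.sub_im]
      ring
    apply Complex.ext
    · simp only [Complex.add_re, Complex.real_smul, Complex.re_ofReal_mul]
      field_simp
      linarith
    · simp only [Complex.add_im, Complex.real_smul, Complex.im_ofReal_mul]
      field_simp
      linarith
  rw [hz]
  have hc := convex_convexHull ℝ S
  have hmem := hc.sum_mem (t := Finset.univ) (w := ![s / T, t / T, r / T]) (z := ![u, v, w])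
    (by intro i _; fin_cases i <;> simp <;> positivity)
    (by simp [Fin.sum_univ_three]; field_simp; linarith)
    (by intro i _; fin_cases i <;> simp <;> apply subset_convexHull <;> assumption)
  simpa [Fin.sum_univ_three] using hmem

/-- The condition is open, so membership in the hull suffices. The diagonal from `x 0` to `x 2` cuts
the quadrilateral into two triangles, and the sign of the form of that diagonal decides which of
them contains the point. -/
theorem IsConvexCCW.mem_interior {x : Fin 4 → ℂ} (hx : IsConvexCCW x) {z : ℂ}
    (hz : ∀ i, 0 < sideForm x i z) : z ∈ interior (convexHull ℝ (Set.range x)) := by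
  have hopen : IsOpen {z | ∀ i, 0 < sideForm x i z} := by
    rw [ofPred_forall]
    exact isOpen_iInter_of_finite fun i => isOpen_lt continuous_const (continuous_sideForm x i)
  refine _root_.mem_interior.2 ⟨_, ?_, hopen, hz⟩
  intro z hz
  have h0 := hz 0
  have h1 := hz 1
  have h2 := hz 2
  have h3 := hz 3
  have t1 := hx 0 2 (by decide) (by decide)
  have t2 := hx 2 0 (by decide) (by decide)
  simp only [sideForm, zero_add, Fin.reduceAdd] at h0 h1 h2 h3 t1 t2
  rcases le_total 0 ((x 2 - x 0).re * (z - x 0).im - (x 2 - x 0).im * (z - x 0).re) with h | h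
  · refine mem_convexHull_triangle (u := x 0) (v := x 2) (w := x 3) ⟨0, rfl⟩ ⟨2, rfl⟩ ⟨3, rfl⟩
      ?_ h h2.le h3.le
    calc 0 < _ := t2
      _ = _ := by simp only [Complex.sub_re, Complex.sub_im]; ring
  · refine mem_convexHull_triangle (u := x 0) (v := x 1) (w := x 2) ⟨0, rfl⟩ ⟨1, rfl⟩ ⟨2, rfl⟩
      t1 h0.le h1.le ?_
    simp only [Complex.sub_re, Complex.sub_im] at h ⊢
    nlinarith

/-- A point of the supporting line could otherwise be moved a little along the outer normal without
leaving the hull, where the form is nonnegative. -/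
theorem IsConvexCCW.notMem_interior {x : Fin 4 → ℂ} (hx : IsConvexCCW x) {z : ℂ} {i : Fin 4}
    (hz : sideForm x i z = 0) : z ∉ interior (convexHull ℝ (Set.range x)) := by
  intro hmem
  have hsub : ∀ z ∈ convexHull ℝ (Set.range x), 0 ≤ sideForm x i z := by
    refine convexHull_min (t := {z | 0 ≤ sideForm x i z}) ?_ ?_
    · rintro _ ⟨k, rfl⟩
      exact hx.sideForm_nonneg i k
    · intro u hu v hv a b ha hb hab
      rw [mem_ofPred_eq, sideForm_combo x i hab]
      exact add_nonneg (mul_nonneg ha hu) (mul_nonneg hb hv)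
  set e := x (i + 1) - x i with he
  have hcont : Continuous fun r : ℝ => z - r * (Complex.I * e) := by fun_prop
  have hnh : ∀ᶠ r : ℝ in 𝓝 (0 : ℝ), z - r * (Complex.I * e) ∈ interior (convexHull ℝ (Set.range x)) :=
    hcont.continuousAt.eventually ((isOpen_interior (s := convexHull ℝ (Set.range x))).mem_nhds
      (by simpa using hmem))
  obtain ⟨r, hr, hr0⟩ := ((hnh.filter_mono nhdsWithin_le_nhds).and
    (self_mem_nhdsWithin : Ioi (0 : ℝ) ∈ 𝓝[>] 0)).exists
  have h1 := hsub _ (interior_subset hr)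
  have h2 : sideForm x i (z - r * (Complex.I * e)) =
      sideForm x i z - r * (e.re ^ 2 + e.im ^ 2) := by
    simp only [sideForm, ← he]
    simp
    ring
  have h3 : 0 < e.re ^ 2 + e.im ^ 2 := by
    by_contra h
    have hre : e.re = 0 := by nlinarith [sq_nonneg e.re, sq_nonneg e.im]
    have him : e.im = 0 := by nlinarith [sq_nonneg e.re, sq_nonneg e.im]
    have := hx i (i + 2) (by simp) (by simp)
    rw [← he, hre, him] at this
    simp at this
  rw [h2, hz] at h1
  nlinarith [mul_pos hr0 h3]

/-- Mind the shift: the side on the line `L m` runs from `x (m + 3)` to `x m`, so it belongs to the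
form with index m + 3. -/
theorem IsConvexCCW.sideForm_openSegment {x : Fin 4 → ℂ} (hx : IsConvexCCW x) {i m : Fin 4} {A : ℂ}
    (hA : A ∈ openSegment ℝ (x (i + 3)) (x i)) : 0 ≤ sideForm x (m + 3) A ∧
      (m ≠ i → 0 < sideForm x (m + 3) A) ∧ (m = i → sideForm x (m + 3) A = 0) := by
  obtain ⟨a, b, ha, hb, hab, rfl⟩ := hA
  rw [sideForm_combo x _ hab]
  have h1 := hx.sideForm_nonneg (m + 3) (i + 3)
  have h2 := hx.sideForm_nonneg (m + 3) i
  refine ⟨by positivity, fun hm => ?_, ?_⟩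
  · by_cases h : i = m + 3
    · have : 0 < sideForm x (m + 3) (x (i + 3)) := by
        refine hx _ _ ?_ ?_
        · rw [h]
          exact (by decide : ∀ m : Fin 4, m + 3 + 3 ≠ m + 3) m
        · rw [h]
          exact (by decide : ∀ m : Fin 4, m + 3 + 3 ≠ m + 3 + 1) m
      positivity
    · have : 0 < sideForm x (m + 3) (x i) := by
        exact hx _ _ h ((by decide : ∀ m i : Fin 4, m ≠ i → i ≠ m + 3 + 1) m i hm)
      positivity
  · rintro rfl
    have := sideForm_vertex x (m + 3)
    rw [add_assoc] at this
    have e : (3 + 1 : Fin 4) = 0 := rfl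
    rw [e, add_zero] at this
    rw [this.1, this.2]
    simp

/-- The length-area estimate for a ruled family of segments that connect opposite sides of a
convex quadrilateral. -/
theorem IsSchwarzChristoffel.length_area_of_isConvexCCW {L : Fin 4 → Set ℂ} {x : Fin 4 → ℂ} {ξ : ℝ}
    {w : ℂ → ℂ} (hw : IsSchwarzChristoffel L x ξ w) (hx : IsConvexCCW x)
    (hL : ∀ i, x i ∈ L i ∧ x i ∈ L (i + 1)) (hL' : ∀ m, ∀ z ∈ L m, sideForm x (m + 3) z = 0)
    (hξ : ξ ∈ Ioo (0 : ℝ) 1) (i : Fin 4) {A₀ A₁ D₀ D₁ : ℂ} {j ℓ : ℝ} (hj : 0 < j) (hℓ : 0 < ℓ)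
    (hA : ∀ s ∈ Ioo (0 : ℝ) 1, A₀ + s * A₁ ∈ openSegment ℝ (x (i + 3)) (x i))
    (hB : ∀ s ∈ Ioo (0 : ℝ) 1,
      A₀ + s * A₁ + (D₀ + s * D₁) ∈ openSegment ℝ (x (i + 2 + 3)) (x (i + 2)))
    (hjac : ∀ s ∈ Ioo (0 : ℝ) 1, ∀ t ∈ Ioo (0 : ℝ) 1,
      j ≤ (A₁ + t * D₁).re * (D₀ + s * D₁).im - (A₁ + t * D₁).im * (D₀ + s * D₁).re)
    (hlen : ∀ s ∈ Ioo (0 : ℝ) 1, ‖D₀ + s * D₁‖ ≤ ℓ) :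
    j * Real.log ((1 + arcRadius ξ i ^ 2) / (2 * arcRadius ξ i)) ^ 2 ≤
      ℓ ^ 2 * (-Real.log (arcRadius ξ i) * Real.pi) := by
  have hside : ∀ {i : Fin 4} {A : ℂ}, A ∈ openSegment ℝ (x (i + 3)) (x i) →
      A ∉ interior (convexHull ℝ (Set.range x)) ∧ ∀ m ≠ i, A ∉ L m := by
    intro i A hA
    refine ⟨hx.notMem_interior ((hx.sideForm_openSegment hA).2.2 rfl), fun m hm hmem => ?_⟩
    exact ((hx.sideForm_openSegment hA).2.1 hm).ne' (hL' m A hmem)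
  refine hw.length_area hL hξ i hj hℓ (fun s hs t ht => ?_) (fun s hs => hside (hA s hs))
    (fun s hs => hside (hB s hs)) hjac hlen
  apply hx.mem_interior
  intro k
  obtain ⟨m, rfl⟩ : ∃ m, k = m + 3 := ⟨k - 3, by simp⟩
  have e : A₀ + s * A₁ + t * (D₀ + s * D₁) =
      (1 - t) • (A₀ + s * A₁) + t • (A₀ + s * A₁ + (D₀ + s * D₁)) := by
    simp only [Complex.real_smul]
    push_cast
    ring
  rw [e, sideForm_combo x _ (by ring)]
  have h1 := hx.sideForm_openSegment (m := m) (hA s hs)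
  have h2 := hx.sideForm_openSegment (m := m) (hB s hs)
  have ht0 := ht.1
  have ht1 := sub_pos.2 ht.2
  by_cases hm : m = i
  · have := h2.2.1 (by rw [hm]; simp)
    have := h1.1
    positivity
  · have := h1.2.1 hm
    have := h2.1
    positivity

/-! ### The combinatorics of abscissas and slopes -/

/-- The lines `y = a i x + b i` bound a convex quadrilateral whose vertices, on the lines `i` and
`i + 1`, have the abscissas `p i` and follow each other counterclockwise. -/
structure AffineQuad (a b p : Fin 4 → ℝ) : Prop where
  crit : ∀ i, a (i + 1) * p i + b (i + 1) = a i * p i + b i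
  -- This is the cross product of the two edges meeting at vertex i, whose slopes are `a i` and `a
  -- (i + 1)`.
  conv : ∀ i, 0 < (p i - p (i + 3)) * (p (i + 1) - p i) * (a (i + 1) - a i)

/-- The vertices `i + 2`, `i + 3` lie on the left of the vertices `i`, `i + 1`. -/
structure IsSeparated (p : Fin 4 → ℝ) (i : Fin 4) : Prop where
  h20 : p (i + 2) < p i
  h21 : p (i + 2) < p (i + 1)
  h30 : p (i + 3) < p i
  h31 : p (i + 3) < p (i + 1)

/-- The vertices `i` and `i + 2` lie on the same vertical, between `i + 3` and `i + 1`. -/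
structure IsAligned (p : Fin 4 → ℝ) (i : Fin 4) : Prop where
  h30 : p (i + 3) < p i
  h02 : p (i + 2) = p i
  h01 : p i < p (i + 1)

namespace AffineQuad

variable {a b p : Fin 4 → ℝ}

theorem crit_all (h : AffineQuad a b p) (i : Fin 4) :
    a (i + 1) * p i + b (i + 1) = a i * p i + b i ∧
    a (i + 2) * p (i + 1) + b (i + 2) = a (i + 1) * p (i + 1) + b (i + 1) ∧
    a (i + 3) * p (i + 2) + b (i + 3) = a (i + 2) * p (i + 2) + b (i + 2) ∧
    a i * p (i + 3) + b i = a (i + 3) * p (i + 3) + b (i + 3) := by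
  have h1 := h.crit (i + 1)
  have h2 := h.crit (i + 2)
  have h3 := h.crit (i + 3)
  simp only [add_assoc, Fin.reduceAdd, add_zero] at h1 h2 h3
  exact ⟨h.crit i, h1, h2, h3⟩

theorem conv_all (h : AffineQuad a b p) (i : Fin 4) :
    0 < (p i - p (i + 3)) * (p (i + 1) - p i) * (a (i + 1) - a i) ∧
    0 < (p (i + 1) - p i) * (p (i + 2) - p (i + 1)) * (a (i + 2) - a (i + 1)) ∧
    0 < (p (i + 2) - p (i + 1)) * (p (i + 3) - p (i + 2)) * (a (i + 3) - a (i + 2)) ∧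
    0 < (p (i + 3) - p (i + 2)) * (p i - p (i + 3)) * (a i - a (i + 3)) := by
  have h1 := h.conv (i + 1)
  have h2 := h.conv (i + 2)
  have h3 := h.conv (i + 3)
  simp only [add_assoc, Fin.reduceAdd, add_zero] at h1 h2 h3
  exact ⟨h.conv i, h1, h2, h3⟩

theorem ne_succ (h : AffineQuad a b p) (i : Fin 4) : p (i + 1) ≠ p i := fun e => by
  simpa [e] using h.conv i

/-- If the abscissa turned back at every vertex, convexity would force the slope to drop at every
step of the cycle. -/
theorem exists_monotone (h : AffineQuad a b p) :
    ∃ i, 0 < (p i - p (i + 3)) * (p (i + 1) - p i) := by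
  by_contra! hcon
  have key : ∀ i, a (i + 1) < a i := by
    intro i
    by_contra! hle
    exact (h.conv i).not_ge (mul_nonpos_of_nonpos_of_nonneg (hcon i) (sub_nonneg.2 hle))
  have h0 := key 0
  have h1 := key 1
  have h2 := key 2
  have h3 := key 3
  simp only [zero_add, Fin.reduceAdd] at h0 h1 h2 h3
  linarith

/-- Start at a vertex i through which the abscissa passes monotonically. The position of the
opposite vertex i + 2 relative to the vertical through i then decides the case, and equality is the
aligned one. -/
theorem separated_or_aligned (h : AffineQuad a b p) :
    (∃ i, IsSeparated p i) ∨ (∃ i, IsAligned p i) := by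
  obtain ⟨i, hi⟩ := h.exists_monotone
  rcases pos_and_pos_or_neg_and_neg_of_mul_pos hi with ⟨h1, h2⟩ | ⟨h1, h2⟩ <;>
    rcases lt_trichotomy (p (i + 2)) (p i) with h3 | h3 | h3
  · exact .inl ⟨i, h3, by linarith, by linarith, by linarith⟩
  · exact .inr ⟨i, by linarith, h3, by linarith⟩
  · refine .inl ⟨i + 1, ?_, ?_, ?_, ?_⟩ <;> simp only [add_assoc, Fin.reduceAdd, add_zero] <;>
      linarith
  · refine .inl ⟨i + 3, ?_, ?_, ?_, ?_⟩ <;> simp only [add_assoc, Fin.reduceAdd, add_zero] <;>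
      linarith
  · refine .inr ⟨i + 2, ?_, ?_, ?_⟩ <;> simp only [add_assoc, Fin.reduceAdd, add_zero] <;>
      linarith
  · refine .inl ⟨i + 2, ?_, ?_, ?_, ?_⟩ <;> simp only [add_assoc, Fin.reduceAdd, add_zero] <;>
      linarith

/-- The right one of the vertices on the left and the left one of the vertices on the right. -/
theorem separated_facts (h : AffineQuad a b p) {i : Fin 4} (hi : IsSeparated p i) :
    ∃ c₀ c₁, c₁ < c₀ ∧ (c₀ ≤ p i ∧ c₀ ≤ p (i + 1) ∧ p (i + 2) ≤ c₁ ∧ p (i + 3) ≤ c₁) ∧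
      0 < (a (i + 2) * c₀ + b (i + 2)) - (a i * c₀ + b i) ∧
      0 < (a (i + 2) * c₁ + b (i + 2)) - (a i * c₁ + b i) ∧
      ((p i = c₀ ∧ a i < a (i + 1) ∧ a (i + 2) < a (i + 1)) ∨
        (p (i + 1) = c₀ ∧ a (i + 1) < a (i + 2) ∧ a (i + 1) < a i)) ∧
      ((p (i + 2) = c₁ ∧ a (i + 2) < a (i + 3) ∧ a i < a (i + 3)) ∨
        (p (i + 3) = c₁ ∧ a (i + 3) < a i ∧ a (i + 3) < a (i + 2))) := by
  obtain ⟨h20, h21, h30, h31⟩ := hi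
  obtain ⟨k0, k1, k2, k3⟩ := h.conv_all i
  obtain ⟨e0, e1, e2, e3⟩ := h.crit_all i
  -- `c₀` is the smaller of `p i` and `p (i + 1)`. The slope inequalities say that this abscissa is
  -- a minimum of the corresponding difference of functions and the other one a maximum, so only
  -- `c₀` will pin an interior vertex. The part `left` is analogous with the larger abscissa `c₁`.
  have right : ∃ c₀, (c₀ = p i ∨ c₀ = p (i + 1)) ∧ c₀ ≤ p i ∧ c₀ ≤ p (i + 1) ∧
      0 < (a (i + 2) * c₀ + b (i + 2)) - (a i * c₀ + b i) ∧
      ((p i = c₀ ∧ a i < a (i + 1) ∧ a (i + 2) < a (i + 1)) ∨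
        (p (i + 1) = c₀ ∧ a (i + 1) < a (i + 2) ∧ a (i + 1) < a i)) := by
    rcases lt_trichotomy (p (i + 1)) (p i) with h' | h' | h'
    · have m0 : a (i + 1) - a i < 0 :=
        (neg_iff_neg_of_mul_pos k0).1 (mul_neg_of_pos_of_neg (by linarith) (by linarith))
      have m1 : 0 < a (i + 2) - a (i + 1) :=
        (pos_iff_pos_of_mul_pos k1).1 (mul_pos_of_neg_of_neg (by linarith) (by linarith))
      refine ⟨p (i + 1), .inr rfl, h'.le, le_rfl, ?_, .inr ⟨rfl, by linarith, by linarith⟩⟩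
      nlinarith
    · exact absurd h' (h.ne_succ i)
    · have m0 : 0 < a (i + 1) - a i :=
        (pos_iff_pos_of_mul_pos k0).1 (mul_pos (by linarith) (by linarith))
      have m1 : a (i + 2) - a (i + 1) < 0 :=
        (neg_iff_neg_of_mul_pos k1).1 (mul_neg_of_pos_of_neg (by linarith) (by linarith))
      refine ⟨p i, .inl rfl, le_rfl, h'.le, ?_, .inl ⟨rfl, by linarith, by linarith⟩⟩
      nlinarith
  have left : ∃ c₁, (c₁ = p (i + 2) ∨ c₁ = p (i + 3)) ∧ p (i + 2) ≤ c₁ ∧ p (i + 3) ≤ c₁ ∧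
      0 < (a (i + 2) * c₁ + b (i + 2)) - (a i * c₁ + b i) ∧
      ((p (i + 2) = c₁ ∧ a (i + 2) < a (i + 3) ∧ a i < a (i + 3)) ∨
        (p (i + 3) = c₁ ∧ a (i + 3) < a i ∧ a (i + 3) < a (i + 2))) := by
    have hne := h.ne_succ (i + 2)
    simp only [add_assoc, Fin.reduceAdd] at hne
    rcases lt_trichotomy (p (i + 3)) (p (i + 2)) with h' | h' | h'
    · have m2 : 0 < a (i + 3) - a (i + 2) :=
        (pos_iff_pos_of_mul_pos k2).1 (mul_pos_of_neg_of_neg (by linarith) (by linarith))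
      have m3 : a i - a (i + 3) < 0 :=
        (neg_iff_neg_of_mul_pos k3).1 (mul_neg_of_neg_of_pos (by linarith) (by linarith))
      refine ⟨p (i + 2), .inl rfl, le_rfl, h'.le, ?_, .inl ⟨rfl, by linarith, by linarith⟩⟩
      nlinarith
    · exact absurd h' hne
    · have m2 : a (i + 3) - a (i + 2) < 0 :=
        (neg_iff_neg_of_mul_pos k2).1 (mul_neg_of_neg_of_pos (by linarith) (by linarith))
      have m3 : 0 < a i - a (i + 3) :=
        (pos_iff_pos_of_mul_pos k3).1 (mul_pos (by linarith) (by linarith))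
      refine ⟨p (i + 3), .inr rfl, h'.le, le_rfl, ?_, .inr ⟨rfl, by linarith, by linarith⟩⟩
      nlinarith
  obtain ⟨c₀, hc₀, r1, r2, r3, r4⟩ := right
  obtain ⟨c₁, hc₁, l1, l2, l3, l4⟩ := left
  refine ⟨c₀, c₁, ?_, ⟨r1, r2, l1, l2⟩, r3, l3, r4, l4⟩
  rcases hc₀ with rfl | rfl <;> rcases hc₁ with rfl | rfl <;> assumption

/-- The vertices i and i + 2 are minima of their differences of functions, the other two are maxima.
Both heights are the length of the vertical diagonal, since vertex i lies on the lines i and i + 1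
and vertex i + 2 on the lines i + 2 and i + 3. -/
theorem aligned_facts (h : AffineQuad a b p) {i : Fin 4} (hi : IsAligned p i) :
    (a i < a (i + 1) ∧ a (i + 2) < a (i + 1) ∧ a (i + 2) < a (i + 3) ∧ a i < a (i + 3)) ∧
    0 < (a (i + 2) * p i + b (i + 2)) - (a i * p i + b i) ∧
    0 < (a (i + 3) * p i + b (i + 3)) - (a (i + 1) * p i + b (i + 1)) := by
  obtain ⟨h30, h02, h01⟩ := hi
  obtain ⟨k0, k1, k2, k3⟩ := h.conv_all i
  obtain ⟨e0, e1, e2, e3⟩ := h.crit_all i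
  rw [h02] at k1 k2 k3 e2
  have m0 : 0 < a (i + 1) - a i :=
    (pos_iff_pos_of_mul_pos k0).1 (mul_pos (by linarith) (by linarith))
  have m1 : a (i + 2) - a (i + 1) < 0 :=
    (neg_iff_neg_of_mul_pos k1).1 (mul_neg_of_pos_of_neg (by linarith) (by linarith))
  have m2 : 0 < a (i + 3) - a (i + 2) :=
    (pos_iff_pos_of_mul_pos k2).1 (mul_pos_of_neg_of_neg (by linarith) (by linarith))
  have m3 : a i - a (i + 3) < 0 :=
    (neg_iff_neg_of_mul_pos k3).1 (mul_neg_of_neg_of_pos (by linarith) (by linarith))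
  refine ⟨⟨by linarith, by linarith, by linarith, by linarith⟩, ?_, ?_⟩ <;> nlinarith

end AffineQuad

/-! ### Families of segments between opposite sides -/

theorem mk_mem_openSegment {a b c r X : ℝ} {u v : ℂ} (hu : u = ⟨r, c * (a * r + b)⟩) {r' : ℝ}
    (hv : v = ⟨r', c * (a * r' + b)⟩) (hX : 0 < (X - r) * (r' - X)) :
    (⟨X, c * (a * X + b)⟩ : ℂ) ∈ openSegment ℝ u v := by
  have hne : r' - r ≠ 0 := by
    intro h
    obtain rfl : r' = r := by linarith
    nlinarith [sq_nonneg (X - r')]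
  have h1 : 0 < (X - r) / (r' - r) := by
    rcases pos_and_pos_or_neg_and_neg_of_mul_pos hX with ⟨h1, h2⟩ | ⟨h1, h2⟩
    · exact div_pos h1 (by linarith)
    · exact div_pos_of_neg_of_neg h1 (by linarith)
  have h2 : 0 < (r' - X) / (r' - r) := by
    rcases pos_and_pos_or_neg_and_neg_of_mul_pos hX with ⟨h1, h2⟩ | ⟨h1, h2⟩
    · exact div_pos h2 (by linarith)
    · exact div_pos_of_neg_of_neg h2 (by linarith)
  refine ⟨(r' - X) / (r' - r), (X - r) / (r' - r), h2, h1, ?_, ?_⟩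
  · field_simp
    ring
  · rw [hu, hv]
    apply Complex.ext
    · simp only [Complex.add_re, Complex.real_smul, Complex.re_ofReal_mul]
      field_simp
      ring
    · simp only [Complex.add_im, Complex.real_smul, Complex.im_ofReal_mul]
      field_simp
      ring

/-- The length-area estimate for segments between the `i`-th and the `i + 2`-nd side; the
coefficients of the sides are those of `AffineQuad`, scaled vertically by `ε`. -/
theorem AffineQuad.length_area {a b p : Fin 4 → ℝ} {ε : ℝ} {L : Fin 4 → Set ℂ}
    {x : Fin 4 → ℂ} {ξ : ℝ} {w : ℂ → ℂ} (h : AffineQuad a b p)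
    (hx : ∀ i, x i = ⟨p i, ε * (a i * p i + b i)⟩)
    (hL : ∀ i, L i = {z : ℂ | z.im = ε * (a i * z.re + b i)}) (hconv : IsConvexCCW x)
    (hw : IsSchwarzChristoffel L x ξ w) (hξ : ξ ∈ Ioo (0 : ℝ) 1) (hε : 0 < ε) (i : Fin 4)
    {α β τ j ℓ : ℝ} (hj : 0 < j) (hℓ : 0 < ℓ)
    (hα : ∀ s ∈ Ioo (0 : ℝ) 1, 0 < (α + s * τ - p (i + 3)) * (p i - (α + s * τ)))
    (hβ : ∀ s ∈ Ioo (0 : ℝ) 1, 0 < (β + s * τ - p (i + 1)) * (p (i + 2) - (β + s * τ)))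
    (hjac : ∀ s ∈ Ioo (0 : ℝ) 1, ∀ t ∈ Ioo (0 : ℝ) 1,
      j ≤ ε * τ * ((a (i + 2) * (β + s * τ) + b (i + 2)) - (a i * (α + s * τ) + b i) -
        (β - α) * (a i + t * (a (i + 2) - a i))))
    (hlen : ∀ s ∈ Ioo (0 : ℝ) 1, |β - α| +
      ε * |(a (i + 2) * (β + s * τ) + b (i + 2)) - (a i * (α + s * τ) + b i)| ≤ ℓ) :
    j * Real.log ((1 + arcRadius ξ i ^ 2) / (2 * arcRadius ξ i)) ^ 2 ≤
      ℓ ^ 2 * (-Real.log (arcRadius ξ i) * Real.pi) := by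
  have hx' : ∀ i, x i = ⟨p i, ε * (a (i + 1) * p i + b (i + 1))⟩ := fun i => by
    rw [hx, h.crit]
  have hxL : ∀ i, x i ∈ L i ∧ x i ∈ L (i + 1) := by
    intro i
    rw [hL, hL]
    constructor
    · rw [hx]; rfl
    · rw [hx']; rfl
  have hx3 : ∀ m, x (m + 3) = ⟨p (m + 3), ε * (a m * p (m + 3) + b m)⟩ := by
    intro m
    have := hx' (m + 3)
    simpa only [add_assoc, Fin.reduceAdd, add_zero] using this
  have hL' : ∀ m, ∀ z ∈ L m, sideForm x (m + 3) z = 0 := by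
    intro m z hz
    rw [hL, mem_ofPred_eq] at hz
    have e : m + 3 + 1 = m := by simp only [add_assoc, Fin.reduceAdd, add_zero]
    rw [sideForm, e, hx3, hx m]
    simp only [Complex.sub_re, Complex.sub_im, hz]
    ring
  -- The s-th segment joins the points of the sides i and i + 2 with abscissas α + sτ and β + sτ.
  -- Both ends move at the same horizontal speed, so `D₁` is vertical.
  set A₀ : ℂ := ⟨α, ε * (a i * α + b i)⟩ with hA₀
  set A₁ : ℂ := ⟨τ, ε * (a i * τ)⟩ with hA₁
  set D₀ : ℂ := ⟨β - α, ε * ((a (i + 2) * β + b (i + 2)) - (a i * α + b i))⟩ with hD₀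
  set D₁ : ℂ := ⟨0, ε * ((a (i + 2) - a i) * τ)⟩ with hD₁
  have eA : ∀ s : ℝ, A₀ + s * A₁ = ⟨α + s * τ, ε * (a i * (α + s * τ) + b i)⟩ := by
    intro s
    apply Complex.ext
    · simp only [Complex.add_re, Complex.re_ofReal_mul, hA₀, hA₁]
    · simp only [Complex.add_im, Complex.im_ofReal_mul, hA₀, hA₁]
      ring
  have eB : ∀ s : ℝ, A₀ + s * A₁ + (D₀ + s * D₁) =
      ⟨β + s * τ, ε * (a (i + 2) * (β + s * τ) + b (i + 2))⟩ := by
    intro s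
    apply Complex.ext
    · simp only [Complex.add_re, Complex.re_ofReal_mul, hA₀, hA₁, hD₀, hD₁]
      ring
    · simp only [Complex.add_im, Complex.im_ofReal_mul, hA₀, hA₁, hD₀, hD₁]
      ring
  refine hw.length_area_of_isConvexCCW hconv hxL hL' hξ i hj hℓ (A₀ := A₀) (A₁ := A₁) (D₀ := D₀)
    (D₁ := D₁) (fun s hs => ?_) (fun s hs => ?_) (fun s hs t ht => ?_) (fun s hs => ?_)
  · rw [eA]
    exact mk_mem_openSegment (hx3 i) (hx i) (hα s hs)
  · rw [eB]
    refine mk_mem_openSegment (hx3 (i + 2)) (hx (i + 2)) ?_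
    have e : i + 2 + 3 = i + 1 := by simp only [add_assoc, Fin.reduceAdd]
    rw [e]
    exact hβ s hs
  · refine (hjac s hs t ht).trans_eq ?_
    simp only [Complex.add_re, Complex.add_im, Complex.re_ofReal_mul, Complex.im_ofReal_mul,
      hA₁, hD₀, hD₁]
    ring
  · refine (Complex.norm_le_abs_re_add_abs_im _).trans (le_trans (le_of_eq ?_) (hlen s hs))
    have e : ∀ y, ε * |y| = |ε * y| := fun y => by rw [abs_mul, abs_of_pos hε]
    rw [e]
    congr 2
    · simp [hD₀, hD₁]
    · simp only [Complex.add_im, Complex.im_ofReal_mul, hD₀, hD₁]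
      ring

/-! ### Degeneration of the fourth marked point -/

/-- If the `log cosh` of `u = -log η` is at most of the order of `√u`, then `u` is bounded. -/
theorem neg_log_le_of_sq_le {η K : ℝ} (hη : η ∈ Ioo (0 : ℝ) 1) (hK : 0 ≤ K)
    (h : Real.log ((1 + η ^ 2) / (2 * η)) ^ 2 ≤ K * -Real.log η) : -Real.log η ≤ K + 2 := by
  have hη0 := hη.1
  -- With u = -log η the logarithm is at least u - log 2 ≥ u - 1, and (u - 1)² ≤ Ku fails for u > K
  -- + 2.
  have h1 : -Real.log η - 1 ≤ Real.log ((1 + η ^ 2) / (2 * η)) := by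
    have h2 : Real.log (1 / (2 * η)) ≤ Real.log ((1 + η ^ 2) / (2 * η)) := by
      apply Real.log_le_log (by positivity)
      gcongr
      nlinarith
    rw [one_div, Real.log_inv, Real.log_mul two_ne_zero hη0.ne'] at h2
    linarith [Real.log_two_lt_d9]
  by_contra! hcon
  have h3 : (-Real.log η - 1) ^ 2 ≤ Real.log ((1 + η ^ 2) / (2 * η)) ^ 2 := by
    apply pow_le_pow_left₀ (by linarith) h1
  nlinarith

/-- From log y ≥ 1 - 1/y. It turns smallness of the distance between the arcs into closeness of η to
1. -/
theorem sq_one_sub_le_log {η : ℝ} (hη : η ∈ Ioo (0 : ℝ) 1) :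
    (1 - η) ^ 2 / 2 ≤ Real.log ((1 + η ^ 2) / (2 * η)) := by
  have hη0 := hη.1
  have h1 := Real.one_sub_inv_le_log_of_pos (x := (1 + η ^ 2) / (2 * η)) (by positivity)
  refine le_trans ?_ h1
  rw [inv_div]
  have e : 1 - 2 * η / (1 + η ^ 2) = (1 - η) ^ 2 / (1 + η ^ 2) := by
    field_simp
    ring
  rw [e]
  gcongr
  nlinarith [hη.2]

theorem arcRadius_mem {ξ : ℝ} (hξ : ξ ∈ Ioo (0 : ℝ) 1) (i : Fin 4) :
    arcRadius ξ i ∈ Ioo (0 : ℝ) 1 := by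
  unfold arcRadius
  split_ifs <;> constructor <;> linarith [hξ.1, hξ.2]

section Degeneration

variable {a b p : Fin 4 → ℝ} {L : ℝ → Fin 4 → Set ℂ} {x : ℝ → Fin 4 → ℂ} {ξ : ℝ → ℝ}
  {w : ℝ → ℂ → ℂ}

/-- When the sides `i` and `i + 2` are long, the arcs on them swallow the half plane. -/
theorem AffineQuad.tendsto_of_isSeparated (h : AffineQuad a b p)
    (hx : ∀ ε > 0, ∀ i, x ε i = ⟨p i, ε * (a i * p i + b i)⟩)
    (hL : ∀ ε > 0, ∀ i, L ε i = {z : ℂ | z.im = ε * (a i * z.re + b i)})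
    (hconv : ∀ ε > 0, IsConvexCCW (x ε)) (hξ : ∀ ε > 0, ξ ε ∈ Ioo (0 : ℝ) 1)
    (hw : ∀ ε > 0, IsSchwarzChristoffel (L ε) (x ε) (ξ ε) (w ε)) {i : Fin 4}
    (hi : IsSeparated p i) : Tendsto (fun ε => 1 - arcRadius (ξ ε) i) (𝓝[>] 0) (𝓝 0) := by
  obtain ⟨c₀, c₁, hc, ⟨r1, r2, l1, l2⟩, hF0, hF1, -, -⟩ := h.separated_facts hi
  set F₀ := (a (i + 2) * c₀ + b (i + 2)) - (a i * c₀ + b i) with hF₀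
  set F₁ := (a (i + 2) * c₁ + b (i + 2)) - (a i * c₁ + b i) with hF₁
  set m := min F₀ F₁ with hm
  have hm0 : 0 < m := lt_min hF0 hF1
  have hτ : 0 < c₀ - c₁ := by linarith
  set K := (F₀ + F₁) ^ 2 * Real.pi / ((c₀ - c₁) * m) with hK
  have hK0 : 0 ≤ K := by positivity
  have est : ∀ ε > 0, Real.log ((1 + arcRadius (ξ ε) i ^ 2) / (2 * arcRadius (ξ ε) i)) ^ 2 ≤
      K * ε * -Real.log (arcRadius (ξ ε) i) := by
    intro ε hε
    have hF : ∀ s, (a (i + 2) * (c₁ + s * (c₀ - c₁)) + b (i + 2)) -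
        (a i * (c₁ + s * (c₀ - c₁)) + b i) = (1 - s) * F₁ + s * F₀ := by
      intro s
      rw [hF₀, hF₁]
      ring
    -- Vertical segments over the interval [c₁, c₀]: their heights interpolate between εF₁ and εF₀,
    -- so ℓ and j are both of order ε and ℓ²/j is of order ε.
    have := h.length_area (hx ε hε) (hL ε hε) (hconv ε hε) (hw ε hε) (hξ ε hε) hε i
      (α := c₁) (β := c₁) (τ := c₀ - c₁) (j := ε * (c₀ - c₁) * m) (ℓ := ε * (F₀ + F₁))
      (by positivity) (by positivity) ?_ ?_ ?_ ?_
    · rw [hK, div_mul_eq_mul_div, div_mul_eq_mul_div, le_div_iff₀ (by positivity)]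
      refine le_of_mul_le_mul_left ?_ hε
      calc _ = ε * (c₀ - c₁) * m * Real.log ((1 + arcRadius (ξ ε) i ^ 2) /
            (2 * arcRadius (ξ ε) i)) ^ 2 := by ring
        _ ≤ _ := this
        _ = _ := by ring
    · rintro s ⟨hs0, hs1⟩
      have := mul_pos hs0 hτ
      have := mul_pos (sub_pos.2 hs1) hτ
      exact mul_pos (by linarith) (by linarith)
    · rintro s ⟨hs0, hs1⟩
      have := mul_pos hs0 hτ
      have := mul_pos (sub_pos.2 hs1) hτ
      exact mul_pos_of_neg_of_neg (by linarith) (by linarith)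
    · rintro s ⟨hs0, hs1⟩ t -
      rw [hF]
      gcongr
      have h0 : m ≤ F₀ := min_le_left _ _
      have h1 : m ≤ F₁ := min_le_right _ _
      nlinarith
    · rintro s ⟨hs0, hs1⟩
      rw [hF, sub_self, abs_zero, zero_add, abs_of_nonneg (by nlinarith)]
      exact mul_le_mul_of_nonneg_left (by nlinarith) hε.le
  have bound : ∀ ε ∈ Ioo (0 : ℝ) 1,
      ‖1 - arcRadius (ξ ε) i‖ ≤ √(√(4 * (K * ε * (K + 2)))) := by
    rintro ε ⟨hε, hε1⟩
    have hη := arcRadius_mem (hξ ε hε) i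
    have hu : 0 ≤ -Real.log (arcRadius (ξ ε) i) := by
      linarith [Real.log_nonpos hη.1.le hη.2.le]
    have e1 := est ε hε
    -- The estimate is used twice: with ε < 1 it bounds -log η, and inserted again it makes the
    -- squared distance of order ε. As (1 - η)⁴/4 is below that square, a double square root
    -- appears.
    have e2 : -Real.log (arcRadius (ξ ε) i) ≤ K + 2 := by
      refine neg_log_le_of_sq_le hη hK0 (e1.trans ?_)
      gcongr
      nlinarith
    have e3 := sq_one_sub_le_log hη
    have e4 : ((1 - arcRadius (ξ ε) i) ^ 2 / 2) ^ 2 ≤ K * ε * (K + 2) := by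
      calc _ ≤ _ := pow_le_pow_left₀ (by positivity) e3 2
        _ ≤ _ := e1
        _ ≤ _ := by gcongr
    rw [Real.norm_eq_abs]
    refine Real.abs_le_sqrt ?_
    refine (le_abs_self _).trans (Real.abs_le_sqrt ?_)
    linarith
  have hlim : Tendsto (fun ε : ℝ => √(√(4 * (K * ε * (K + 2))))) (𝓝[>] 0) (𝓝 0) := by
    have hc : Continuous fun ε : ℝ => √(√(4 * (K * ε * (K + 2)))) := by fun_prop
    have := (hc.tendsto 0).mono_left (nhdsWithin_le_nhds (s := Ioi (0 : ℝ)))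
    simpa using this
  refine squeeze_zero_norm' ?_ hlim
  filter_upwards [Ioo_mem_nhdsGT (one_pos (α := ℝ))] with ε hε using bound ε hε

/-- A family of almost vertical segments of size `ε` that connects the sides `i` and `i + 2` near
a vertical line on which the latter lies above the former. -/
theorem AffineQuad.arcRadius_ge_of_short (h : AffineQuad a b p)
    (hx : ∀ ε > 0, ∀ i, x ε i = ⟨p i, ε * (a i * p i + b i)⟩)
    (hL : ∀ ε > 0, ∀ i, L ε i = {z : ℂ | z.im = ε * (a i * z.re + b i)})
    (hconv : ∀ ε > 0, IsConvexCCW (x ε)) (hξ : ∀ ε > 0, ξ ε ∈ Ioo (0 : ℝ) 1)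
    (hw : ∀ ε > 0, IsSchwarzChristoffel (L ε) (x ε) (ξ ε) (w ε)) {i : Fin 4} {P : ℝ}
    (hP : 0 < (a (i + 2) * P + b (i + 2)) - (a i * P + b i)) {r : ℝ} (hr : 0 < r) (σ σ' : ℝ)
    (hσ : σ ∈ Icc (-1 : ℝ) 0) (hσ' : σ' ∈ Icc (-1 : ℝ) 0)
    (hα : ∀ ε ∈ Ioo 0 r, ∀ s ∈ Ioo (0 : ℝ) 1,
      0 < (P + σ * ε + s * ε - p (i + 3)) * (p i - (P + σ * ε + s * ε)))
    (hβ : ∀ ε ∈ Ioo 0 r, ∀ s ∈ Ioo (0 : ℝ) 1,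
      0 < (P + σ' * ε + s * ε - p (i + 1)) * (p (i + 2) - (P + σ' * ε + s * ε))) :
    ∃ δ > 0, ∀ᶠ ε in 𝓝[>] (0 : ℝ), δ ≤ arcRadius (ξ ε) i := by
  set H := (a (i + 2) * P + b (i + 2)) - (a i * P + b i) with hH
  set M := |a i| + |a (i + 2)| with hM
  have hM0 : 0 ≤ M := by positivity
  set K := 2 * (1 + 2 * H) ^ 2 * Real.pi / H with hK
  have hK0 : 0 ≤ K := by positivity
  refine ⟨Real.exp (-(K + 2)), Real.exp_pos _, ?_⟩
  -- The second bound keeps the change of height caused by the slopes below H/4: heights stay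
  -- between 3H/4 and 5H/4, and the slanting of the segments costs at most another H/4.
  have hr' : 0 < min r (H / (4 * (M + 1))) := lt_min hr (by positivity)
  filter_upwards [Ioo_mem_nhdsGT hr'] with ε hε
  have hε0 := hε.1
  have hεr : ε < r := hε.2.trans_le (min_le_left _ _)
  have hεM : ε * M ≤ H / 4 := by
    have := (hε.2.trans_le (min_le_right _ _)).le
    rw [le_div_iff₀ (by positivity)] at this
    nlinarith
  have hη := arcRadius_mem (hξ ε hε0) i
  have hlin : ∀ {c Y : ℝ}, |Y| ≤ ε → |c * Y| ≤ ε * |c| := by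
    intro c Y hY
    rw [abs_mul, mul_comm]
    gcongr
  have hY : ∀ {σ s : ℝ}, σ ∈ Icc (-1 : ℝ) 0 → s ∈ Ioo (0 : ℝ) 1 → |σ * ε + s * ε| ≤ ε := by
    intro σ s hσ hs
    rw [← add_mul, abs_mul, abs_of_pos hε0]
    have : |σ + s| ≤ 1 := abs_le.2 ⟨by linarith [hσ.1, hs.1], by linarith [hσ.2, hs.2]⟩
    nlinarith
  have hheight : ∀ s ∈ Ioo (0 : ℝ) 1, |(a (i + 2) * (P + σ' * ε + s * ε) + b (i + 2)) -
      (a i * (P + σ * ε + s * ε) + b i) - H| ≤ ε * M := by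
    intro s hs
    have e : (a (i + 2) * (P + σ' * ε + s * ε) + b (i + 2)) -
      (a i * (P + σ * ε + s * ε) + b i) - H =
        a (i + 2) * (σ' * ε + s * ε) - a i * (σ * ε + s * ε) := by
      rw [hH]
      ring
    rw [e, hM]
    refine (abs_sub _ _).trans ?_
    linarith [hlin (c := a (i + 2)) (hY hσ' hs), hlin (c := a i) (hY hσ hs)]
  have hδ : |P + σ' * ε - (P + σ * ε)| ≤ ε := by
    have e : P + σ' * ε - (P + σ * ε) = (σ' - σ) * ε := by ring
    rw [e, abs_mul, abs_of_pos hε0]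
    have : |σ' - σ| ≤ 1 := abs_le.2 ⟨by linarith [hσ.2, hσ'.1], by linarith [hσ.1, hσ'.2]⟩
    nlinarith
  -- Both the width of the family and the length of the segments are of order ε, so ℓ²/j does not
  -- depend on ε.
  have main := h.length_area (hx ε hε0) (hL ε hε0) (hconv ε hε0) (hw ε hε0) (hξ ε hε0) hε0 i
      (α := P + σ * ε) (β := P + σ' * ε) (τ := ε) (j := ε * ε * (H / 2)) (ℓ := ε * (1 + 2 * H))
      (by positivity) (by positivity) (hα ε ⟨hε0, hεr⟩) (hβ ε ⟨hε0, hεr⟩) ?_ ?_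
  · have : Real.log ((1 + arcRadius (ξ ε) i ^ 2) / (2 * arcRadius (ξ ε) i)) ^ 2 ≤
        K * -Real.log (arcRadius (ξ ε) i) := by
      rw [hK, div_mul_eq_mul_div, le_div_iff₀ hP]
      refine le_of_mul_le_mul_left ?_ (mul_pos hε0 hε0)
      calc _ = 2 * (ε * ε * (H / 2) * Real.log ((1 + arcRadius (ξ ε) i ^ 2) /
            (2 * arcRadius (ξ ε) i)) ^ 2) := by ring
        _ ≤ 2 * _ := mul_le_mul_of_nonneg_left main zero_le_two
        _ = _ := by ring
    have := neg_log_le_of_sq_le hη hK0 this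
    rw [← Real.le_log_iff_exp_le hη.1]
    linarith
  · rintro s hs t ⟨ht0, ht1⟩
    rw [mul_assoc, mul_assoc]
    gcongr
    have h1 := abs_le.1 (hheight s hs)
    have h2 : |(P + σ' * ε - (P + σ * ε)) * (a i + t * (a (i + 2) - a i))| ≤ ε * M := by
      rw [abs_mul]
      gcongr
      calc _ = |(1 - t) * a i + t * a (i + 2)| := by congr 1; ring
        _ ≤ |(1 - t) * a i| + |t * a (i + 2)| := abs_add_le _ _
        _ = (1 - t) * |a i| + t * |a (i + 2)| := by
          rw [abs_mul, abs_mul, abs_of_pos ht0, abs_of_pos (sub_pos.2 ht1)]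
        _ ≤ _ := by nlinarith [abs_nonneg (a i), abs_nonneg (a (i + 2))]
    have h3 := abs_le.1 h2
    linarith
  · rintro s hs
    have h1 := abs_le.1 (hheight s hs)
    have h2 : |(a (i + 2) * (P + σ' * ε + s * ε) + b (i + 2)) -
      (a i * (P + σ * ε + s * ε) + b i)| ≤ 2 * H := abs_le.2 ⟨by linarith, by linarith⟩
    nlinarith

/-- The sides i and i + 2 lie on opposite sides of the common vertical and end on it, as do the
sides i + 1 and i + 3, so each pair is joined by a short family. The radii for i and i + 1 are ξ and
1 - ξ in some order. The offsets -1 and 0 place the moving endpoint to the left or to the right of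
the vertical. -/
theorem AffineQuad.bounded_of_isAligned (h : AffineQuad a b p)
    (hx : ∀ ε > 0, ∀ i, x ε i = ⟨p i, ε * (a i * p i + b i)⟩)
    (hL : ∀ ε > 0, ∀ i, L ε i = {z : ℂ | z.im = ε * (a i * z.re + b i)})
    (hconv : ∀ ε > 0, IsConvexCCW (x ε)) (hξ : ∀ ε > 0, ξ ε ∈ Ioo (0 : ℝ) 1)
    (hw : ∀ ε > 0, IsSchwarzChristoffel (L ε) (x ε) (ξ ε) (w ε)) {i : Fin 4}
    (hi : IsAligned p i) : ∃ δ > 0, ∀ᶠ ε in 𝓝[>] (0 : ℝ), ξ ε ∈ Icc δ (1 - δ) := by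
  obtain ⟨-, hF, hF'⟩ := h.aligned_facts hi
  obtain ⟨h30, h02, h01⟩ := hi
  have hr : 0 < min (p i - p (i + 3)) (p (i + 1) - p i) :=
    lt_min (by linarith) (by linarith)
  have hsmall : ∀ ε ∈ Ioo 0 (min (p i - p (i + 3)) (p (i + 1) - p i)), ∀ s ∈ Ioo (0 : ℝ) 1,
      ε < p i - p (i + 3) ∧ ε < p (i + 1) - p i ∧ 0 < s * ε ∧ s * ε < ε := by
    intro ε hε s hs
    refine ⟨hε.2.trans_le (min_le_left _ _), hε.2.trans_le (min_le_right _ _),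
      mul_pos hs.1 hε.1, ?_⟩
    nlinarith [mul_pos (sub_pos.2 hs.2) hε.1]
  obtain ⟨δ, hδ, hd⟩ : ∃ δ > 0, ∀ᶠ ε in 𝓝[>] (0 : ℝ), δ ≤ arcRadius (ξ ε) i := by
    refine h.arcRadius_ge_of_short hx hL hconv hξ hw hF hr (-1) 0 (by simp) (by simp) ?_ ?_ <;>
      intro ε hε s hs <;> obtain ⟨k1, k2, k3, k4⟩ := hsmall ε hε s hs
    · exact mul_pos (by linarith) (by linarith)
    · exact mul_pos_of_neg_of_neg (by linarith) (by linarith)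
  obtain ⟨δ', hδ', hd'⟩ : ∃ δ > 0, ∀ᶠ ε in 𝓝[>] (0 : ℝ), δ ≤ arcRadius (ξ ε) (i + 1) := by
    refine h.arcRadius_ge_of_short hx hL hconv hξ hw (P := p i) ?_ hr 0 (-1) (by simp) (by simp)
      ?_ ?_
    · simpa only [add_assoc, Fin.reduceAdd] using hF'
    all_goals
      intro ε hε s hs
      obtain ⟨k1, k2, k3, k4⟩ := hsmall ε hε s hs
      simp only [add_assoc, Fin.reduceAdd, add_zero]
    · exact mul_pos (by linarith) (by linarith)
    · exact mul_pos_of_neg_of_neg (by linarith) (by linarith)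
  refine ⟨min δ δ', lt_min hδ hδ', ?_⟩
  filter_upwards [hd, hd'] with ε h1 h2
  have l1 := min_le_left δ δ'
  have l2 := min_le_right δ δ'
  fin_cases i <;> simp [arcRadius] at h1 h2 <;> constructor <;> linarith

end Degeneration

/-! ### Classification of ribbon trees with four leaves -/

/-- A map whose orbits exhaust three points permutes them cyclically. -/
theorem three_cycle {α : Type*} {g : α → α} {a b c : α} (hab : a ≠ b) (hbc : b ≠ c) (hac : a ≠ c)
    (hg : ∀ x, (x = a ∨ x = b ∨ x = c) → (g x = a ∨ g x = b ∨ g x = c))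
    (hcyc : ∀ x y, (x = a ∨ x = b ∨ x = c) → (y = a ∨ y = b ∨ y = c) → ∃ n : ℕ, g^[n] x = y) :
    (g a = b ∧ g b = c ∧ g c = a) ∨ (g b = a ∧ g a = c ∧ g c = b) := by
  -- An invariant property of one of the points passes to all three. This excludes fixed points and
  -- two-cycles, which leaves only the two three-cycles.
  have inv : ∀ (P : α → Prop) (x y : α), (x = a ∨ x = b ∨ x = c) → (y = a ∨ y = b ∨ y = c) →
      P x → (∀ z, P z → P (g z)) → P y := by
    intro P x y hx hy hP hPg
    obtain ⟨n, rfl⟩ := hcyc x y hx hy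
    clear hy
    induction n with
    | zero => exact hP
    | succ n ih =>
      rw [Function.iterate_succ_apply']
      exact hPg _ ih
  have fix : ∀ x y, (x = a ∨ x = b ∨ x = c) → (y = a ∨ y = b ∨ y = c) → y ≠ x → g x ≠ x := by
    intro x y hx hy hne h
    exact hne (inv (· = x) x y hx hy rfl (by rintro z rfl; exact h))
  have swap : ∀ x y z, (x = a ∨ x = b ∨ x = c) → (z = a ∨ z = b ∨ z = c) → z ≠ x → z ≠ y →
      g x = y → g y ≠ x := by
    intro x y z hx hz hzx hzy h h'
    have := inv (fun t => t = x ∨ t = y) x z hx hz (.inl rfl) (by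
      rintro t (rfl | rfl)
      · exact .inr h
      · exact .inl h')
    tauto
  have fa := fix a b (by tauto) (by tauto) hab.symm
  have fb := fix b a (by tauto) (by tauto) hab
  have fc := fix c a (by tauto) (by tauto) hac
  have ga := hg a (by tauto)
  have gb := hg b (by tauto)
  have gc := hg c (by tauto)
  have s1 := swap a b c (by tauto) (by tauto) hac.symm hbc.symm
  have s2 := swap a c b (by tauto) (by tauto) hab.symm hbc
  have s3 := swap b c a (by tauto) (by tauto) hab hac
  tauto

namespace RibbonTree

/-- The inverse of an isomorphism. -/
def Iso.symm {k : ℕ} [NeZero k] {T T' : RibbonTree k} (φ : T.Iso T') : T'.Iso T where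
  toGraphIso := φ.toGraphIso.symm
  map_leaf i := by
    rw [← φ.map_leaf]
    simp
  map_next v u h := by
    have h' : T.graph.Adj (φ.toGraphIso.symm v) (φ.toGraphIso.symm u) :=
      φ.toGraphIso.symm.map_adj_iff.2 h
    have := φ.map_next _ _ h'
    simp only [RelIso.apply_symm_apply] at this
    rw [← this]
    simp

/-- The composition of isomorphisms. -/
def Iso.trans {k : ℕ} [NeZero k] {T T' T'' : RibbonTree k} (φ : T.Iso T') (ψ : T'.Iso T'') :
    T.Iso T'' where
  toGraphIso := φ.toGraphIso.trans ψ.toGraphIso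
  map_leaf i := by
    simp [φ.map_leaf, ψ.map_leaf]
  map_next v u h := by
    simp only [RelIso.trans_apply]
    rw [φ.map_next v u h, ψ.map_next _ _ (φ.toGraphIso.map_adj_iff.2 h)]

theorem Iso.isInternal {k : ℕ} [NeZero k] {T T' : RibbonTree k} (φ : T.Iso T') {v : T.V}
    (hv : T.IsInternal v) : T'.IsInternal (φ.toGraphIso v) := by
  rintro ⟨i, hi⟩
  refine hv ⟨i, φ.toGraphIso.injective ?_⟩
  rw [φ.map_leaf, hi]

variable (T : RibbonTree 4)

theorem exists_leaf_neighbor {k : ℕ} [NeZero k] (T : RibbonTree k) (i : Fin k) :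
    ∃ u, T.graph.neighborSet (T.leaf i) = {u} :=
  Set.ncard_eq_one.1 ((T.mem_range_leaf _).1 ⟨i, rfl⟩)

theorem leaf_adj_unique {k : ℕ} [NeZero k] (T : RibbonTree k) {i : Fin k} {u v : T.V}
    (hu : T.graph.Adj (T.leaf i) u) (hv : T.graph.Adj (T.leaf i) v) : u = v := by
  obtain ⟨x, hx⟩ := T.exists_leaf_neighbor i
  have h1 : u ∈ T.graph.neighborSet (T.leaf i) := hu
  have h2 : v ∈ T.graph.neighborSet (T.leaf i) := hv
  rw [hx] at h1 h2
  exact h1.trans h2.symm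

theorem next_leaf {k : ℕ} [NeZero k] (T : RibbonTree k) {i : Fin k} {u : T.V}
    (hu : T.graph.Adj (T.leaf i) u) : T.next (T.leaf i) u = u :=
  T.leaf_adj_unique (T.next_adj _ _ hu) hu

/-- Consecutive exterior vertices at an interior vertex have consecutive numbers. -/
theorem succ_of_next_leaf {k : ℕ} [NeZero k] (T : RibbonTree k) {v : T.V} (hv : T.IsInternal v)
    {i i' : Fin k} (hi : T.graph.Adj v (T.leaf i)) (h : T.next v (T.leaf i) = T.leaf i') :
    i' = i + 1 := by
  have h1 := T.region_turn (T.leaf i) v hi.symm hv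
  have h2 := T.next_adj v _ hi
  rw [h] at h1 h2
  rw [T.region_from_leaf i v hi.symm, T.region_to_leaf i' v h2] at h1
  exact h1

open Classical in
/-- There are one or two interior vertices; their valencies are those of a tree. -/
theorem internal_cases : (∃ v, T.IsInternal v ∧ (∀ u, T.IsInternal u → u = v) ∧
      (T.graph.neighborSet v).ncard = 4) ∨
    (∃ v w, v ≠ w ∧ T.IsInternal v ∧ T.IsInternal w ∧ (∀ u, T.IsInternal u → u = v ∨ u = w) ∧
      (T.graph.neighborSet v).ncard = 3 ∧ (T.graph.neighborSet w).ncard = 3) := by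
  have := T.finite
  have : Fintype T.V := Fintype.ofFinite _
  have hdeg : ∀ v, (T.graph.neighborSet v).ncard = T.graph.degree v := by
    intro v
    rw [Set.ncard_eq_toFinset_card', ← SimpleGraph.card_neighborFinset_eq_degree]
    rfl
  simp only [hdeg]
  have hsum := T.graph.sum_degrees_eq_twice_card_edges
  have hcard := T.isTree.card_edgeFinset
  set S : Finset T.V := Finset.univ.filter T.IsInternal with hS
  have hleafset : Finset.univ.filter (fun v => ¬ T.IsInternal v) = Finset.univ.image T.leaf := by
    ext v
    simp [IsInternal]
  have hsplit := Finset.sum_filter_add_sum_filter_not Finset.univ T.IsInternal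
    (fun v => T.graph.degree v)
  have hcsplit := Finset.card_filter_add_card_filter_not (s := Finset.univ) T.IsInternal
  rw [hleafset] at hsplit hcsplit
  rw [Finset.card_image_of_injective _ T.leaf_injective, Finset.card_univ, Finset.card_univ,
    Fintype.card_fin] at hcsplit
  have hleafsum : ∑ v ∈ Finset.univ.image T.leaf, T.graph.degree v = 4 := by
    rw [Finset.sum_image (fun _ _ _ _ h => T.leaf_injective h)]
    have : ∀ i, T.graph.degree (T.leaf i) = 1 := fun i => by
      rw [← hdeg]
      exact (T.mem_range_leaf _).1 ⟨i, rfl⟩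
    simp [this]
  have hge : ∀ v ∈ S, 3 ≤ T.graph.degree v := by
    intro v hv
    have hvi : T.IsInternal v := by simpa [hS] using hv
    have h0 : T.graph.degree v ≠ 0 := by
      have : Nontrivial T.V := ⟨T.leaf 0, T.leaf 1, fun h => by
        simpa using T.leaf_injective h⟩
      exact (T.isTree.connected.preconnected.degree_pos_of_nontrivial v).ne'
    have h1 : T.graph.degree v ≠ 1 := fun h =>
      hvi ((T.mem_range_leaf v).2 ((hdeg v).trans h))
    have h2 : T.graph.degree v ≠ 2 := fun h => T.degree_ne_two v ((hdeg v).trans h)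
    omega
  have hlow : S.card * 3 ≤ ∑ v ∈ S, T.graph.degree v := by
    simpa using Finset.card_nsmul_le_sum S _ 3 hge
  -- With n interior vertices there are n + 3 edges, so the interior valencies add up to 2(n + 3) -
  -- 4. As each is at least 3, n ≤ 2.
  have hSsum : ∑ v ∈ S, T.graph.degree v = 2 * S.card + 2 := by
    have : ∑ v ∈ S, T.graph.degree v + 4 = ∑ v, T.graph.degree v := by rw [← hsplit, hleafsum]
    have hc : S.card + 4 = Fintype.card T.V := hcsplit
    omega
  have hS0 : S.card ≠ 0 := by
    intro h
    rw [Finset.card_eq_zero.1 h] at hSsum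
    simp at hSsum
  have hmem : ∀ u, T.IsInternal u ↔ u ∈ S := fun u => by simp [hS]
  have hS12 : S.card = 1 ∨ S.card = 2 := by omega
  rcases hS12 with h | h
  · left
    obtain ⟨v, hv⟩ := Finset.card_eq_one.1 h
    refine ⟨v, by simp [hmem, hv], fun u hu => by simpa [hmem, hv] using hu, ?_⟩
    rw [hv] at hSsum
    simpa using hSsum
  · right
    obtain ⟨v, w, hvw, hv⟩ := Finset.card_eq_two.1 h
    have h1 := hge v (by simp [hv])
    have h2 := hge w (by simp [hv])
    rw [hv, Finset.sum_pair hvw, Finset.card_pair hvw] at hSsum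
    exact ⟨v, w, hvw, by simp [hmem, hv], by simp [hmem, hv],
      fun u hu => by simpa [hmem, hv] using hu, by omega, by omega⟩

theorem eq_leaf_of_not_isInternal {T : RibbonTree 4} {u : T.V} (hu : ¬ T.IsInternal u) :
    ∃ i, T.leaf i = u := by
  simpa [IsInternal] using hu

theorem leaf_not_isInternal (i : Fin 4) : ¬ T.IsInternal (T.leaf i) := by
  simp [IsInternal]

/-- In a tree with at least one interior vertex next to each exterior one, exterior vertices are
not adjacent. -/
theorem leaf_not_adj_leaf {T : RibbonTree 4} (hadj : ∀ i, ∃ v, T.IsInternal v ∧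
    T.graph.Adj (T.leaf i) v) (i j : Fin 4) : ¬ T.graph.Adj (T.leaf i) (T.leaf j) := by
  intro h
  obtain ⟨v, hv, hv'⟩ := hadj i
  rw [T.leaf_adj_unique hv' h] at hv
  exact T.leaf_not_isInternal j hv

/-- A tree with a single interior vertex is the corolla. -/
theorem corolla_iso_of_internal {v : T.V} (hv : T.IsInternal v) (huniq : ∀ u, T.IsInternal u → u = v)
    (hcard : (T.graph.neighborSet v).ncard = 4) : Nonempty (corolla.Iso T) := by
  have hsub : T.graph.neighborSet v ⊆ Set.range T.leaf := by
    intro u hu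
    by_contra h
    rw [huniq u h] at hu
    exact T.graph.loopless.irrefl v hu
  have hrange : (Set.range T.leaf).ncard = 4 := by
    rw [← Set.image_univ, Set.ncard_image_of_injective _ T.leaf_injective]
    simp [Set.ncard_univ]
  have hfin : (Set.range T.leaf).Finite := Set.finite_range _
  have heq : T.graph.neighborSet v = Set.range T.leaf :=
    Set.eq_of_subset_of_ncard_le hsub (by rw [hrange, hcard]) hfin
  have hadj : ∀ i, T.graph.Adj v (T.leaf i) := fun i => by
    have : T.leaf i ∈ T.graph.neighborSet v := by rw [heq]; exact ⟨i, rfl⟩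
    exact this
  have hll := leaf_not_adj_leaf (T := T) fun i => ⟨v, hv, (hadj i).symm⟩
  let e : Option (Fin 4) → T.V := fun o => o.elim v T.leaf
  have he : Function.Bijective e := by
    constructor
    · rintro (_ | i) (_ | j) h
      · rfl
      · exact absurd ⟨j, h.symm⟩ hv
      · exact absurd ⟨i, h⟩ hv
      · exact congrArg some (T.leaf_injective h)
    · intro u
      by_cases hu : T.IsInternal u
      · exact ⟨none, (huniq u hu).symm⟩
      · obtain ⟨i, hi⟩ := eq_leaf_of_not_isInternal hu
        exact ⟨some i, hi⟩
  refine ⟨⟨⟨Equiv.ofBijective e he, ?_⟩, fun i => rfl, ?_⟩⟩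
  · rintro (_ | i) (_ | j)
    · exact iff_of_false (T.graph.loopless.irrefl v) (by simp [corolla])
    · exact iff_of_true (hadj j) (by simp [corolla])
    · exact iff_of_true (hadj i).symm (by simp [corolla])
    · exact iff_of_false (hll i j) (by simp [corolla])
  · rintro (_ | i) (_ | j) h
    · simp [corolla] at h
    · change T.leaf (j + 1) = T.next v (T.leaf j)
      obtain ⟨i', hi'⟩ : T.next v (T.leaf j) ∈ Set.range T.leaf := by
        rw [← heq]
        exact T.next_adj v _ (hadj j)
      rw [← hi', T.succ_of_next_leaf hv (hadj j) hi'.symm]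
    · exact (T.next_leaf (hadj i).symm).symm
    · simp [corolla] at h

/-- At an interior vertex that is adjacent to exactly one interior vertex and two exterior ones,
the numbers of the latter are consecutive, and the cyclic order is determined. -/
theorem exists_pair {v w : T.V} (hv : T.IsInternal v) (hw : T.IsInternal w)
    {m m' : Fin 4} (hm : m ≠ m') (hN : T.graph.neighborSet v = {T.leaf m, T.leaf m', w}) :
    ∃ i, T.graph.neighborSet v = {T.leaf i, T.leaf (i + 1), w} ∧
      T.next v (T.leaf i) = T.leaf (i + 1) ∧ T.next v (T.leaf (i + 1)) = w ∧
      T.next v w = T.leaf i := by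
  have hmem : ∀ x, (x = T.leaf m ∨ x = T.leaf m' ∨ x = w) ↔ T.graph.Adj v x := by
    intro x
    rw [← SimpleGraph.mem_neighborSet, hN]
    rfl
  have hlw : ∀ i, T.leaf i ≠ w := fun i h => hw ⟨i, h⟩
  have h3 := three_cycle (g := T.next v) (a := T.leaf m) (b := T.leaf m') (c := w)
    (fun h => hm (T.leaf_injective h)) (hlw m') (hlw m)
    (fun x hx => (hmem _).2 (T.next_adj v x ((hmem x).1 hx)))
    (fun x y hx hy => T.next_cyclic v x y ((hmem x).1 hx) ((hmem y).1 hy))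
  rcases h3 with ⟨h1, h2, h3⟩ | ⟨h1, h2, h3⟩
  · obtain rfl := T.succ_of_next_leaf hv ((hmem _).1 (by tauto)) h1
    exact ⟨m, hN, h1, h2, h3⟩
  · obtain rfl := T.succ_of_next_leaf hv ((hmem _).1 (by tauto)) h1
    refine ⟨m', ?_, h1, h2, h3⟩
    rw [hN]
    ext x
    simp only [Set.mem_insert_iff, Set.mem_singleton_iff]
    tauto

open Classical in
/-- A tree with two interior vertices is one of the trees `twoNodeTree i`. -/
theorem twoNodeTree_iso_of_internal {v w : T.V} (hvw : v ≠ w) (hv : T.IsInternal v)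
    (hw : T.IsInternal w) (huniq : ∀ u, T.IsInternal u → u = v ∨ u = w)
    (hcv : (T.graph.neighborSet v).ncard = 3) (hcw : (T.graph.neighborSet w).ncard = 3) :
    ∃ i, Nonempty ((twoNodeTree i).Iso T) := by
  have := T.finite
  have hlw : ∀ i, T.leaf i ≠ w := fun i h => hw ⟨i, h⟩
  have hlv : ∀ i, T.leaf i ≠ v := fun i h => hv ⟨i, h⟩
  set A : Finset (Fin 4) := Finset.univ.filter fun i => T.graph.Adj v (T.leaf i) with hA
  set B : Finset (Fin 4) := Finset.univ.filter fun i => T.graph.Adj w (T.leaf i) with hB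
  have hdisj : Disjoint A B := by
    rw [Finset.disjoint_left]
    intro i hi hi'
    simp only [hA, hB, Finset.mem_filter, Finset.mem_univ, true_and] at hi hi'
    exact hvw (T.leaf_adj_unique hi.symm hi'.symm)
  have hAB : A.card + B.card ≤ 4 := by
    rw [← Finset.card_union_of_disjoint hdisj]
    exact (Finset.card_le_univ _).trans (by simp)
  have hNv : T.graph.neighborSet v ⊆ insert w (T.leaf '' A) := by
    intro u hu
    by_cases hui : T.IsInternal u
    · rcases huniq u hui with rfl | rfl
      · exact absurd hu (T.graph.loopless.irrefl _)
      · exact Set.mem_insert _ _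
    · obtain ⟨i, rfl⟩ := eq_leaf_of_not_isInternal hui
      exact Set.mem_insert_of_mem _ ⟨i, by simpa [hA] using hu, rfl⟩
  have hNw : T.graph.neighborSet w ⊆ insert v (T.leaf '' B) := by
    intro u hu
    by_cases hui : T.IsInternal u
    · rcases huniq u hui with rfl | rfl
      · exact Set.mem_insert _ _
      · exact absurd hu (T.graph.loopless.irrefl _)
    · obtain ⟨i, rfl⟩ := eq_leaf_of_not_isInternal hui
      exact Set.mem_insert_of_mem _ ⟨i, by simpa [hB] using hu, rfl⟩
  have hAc : (T.leaf '' A).ncard = A.card := by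
    rw [Set.ncard_image_of_injective _ T.leaf_injective, Set.ncard_coe_finset]
  have hBc : (T.leaf '' B).ncard = B.card := by
    rw [Set.ncard_image_of_injective _ T.leaf_injective, Set.ncard_coe_finset]
  have hAi : (insert w (T.leaf '' A)).ncard = A.card + 1 := by
    rw [Set.ncard_insert_of_notMem (by rintro ⟨i, -, h⟩; exact hlw i h), hAc]
  have hBi : (insert v (T.leaf '' B)).ncard = B.card + 1 := by
    rw [Set.ncard_insert_of_notMem (by rintro ⟨i, -, h⟩; exact hlv i h), hBc]
  have h1 := Set.ncard_le_ncard hNv (Set.toFinite _)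
  have h2 := Set.ncard_le_ncard hNw (Set.toFinite _)
  have hA2 : A.card = 2 := by omega
  have hB2 : B.card = 2 := by omega
  have hNv' : T.graph.neighborSet v = insert w (T.leaf '' A) :=
    Set.eq_of_subset_of_ncard_le hNv (by omega) (Set.toFinite _)
  have hNw' : T.graph.neighborSet w = insert v (T.leaf '' B) :=
    Set.eq_of_subset_of_ncard_le hNw (by omega) (Set.toFinite _)
  obtain ⟨m, m', hm, hAm⟩ := Finset.card_eq_two.1 hA2
  obtain ⟨n, n', hn, hBn⟩ := Finset.card_eq_two.1 hB2
  have hset : ∀ (u : T.V) (m m' : Fin 4), insert u (T.leaf '' (({m, m'} : Finset (Fin 4)) : Set _)) =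
      {T.leaf m, T.leaf m', u} := by
    intro u m m'
    ext x
    simp only [Finset.coe_insert, Finset.coe_singleton, Set.image_insert_eq, Set.image_singleton,
      Set.mem_insert_iff, Set.mem_singleton_iff]
    tauto
  rw [hAm, hset] at hNv'
  rw [hBn, hset] at hNw'
  obtain ⟨i, hi, i1, i2, i3⟩ := T.exists_pair hv hw hm hNv'
  obtain ⟨j, hj, j1, j2, j3⟩ := T.exists_pair hw hv hn hNw'
  have hadjv : ∀ k, T.graph.Adj v (T.leaf k) ↔ (k = i ∨ k = i + 1) := by
    intro k
    rw [← SimpleGraph.mem_neighborSet, hi]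
    simp [T.leaf_injective.eq_iff, hlw]
  have hadjw : ∀ k, T.graph.Adj w (T.leaf k) ↔ (k = j ∨ k = j + 1) := by
    intro k
    rw [← SimpleGraph.mem_neighborSet, hj]
    simp [T.leaf_injective.eq_iff, hlv]
  have hvw' : T.graph.Adj v w := by
    rw [← SimpleGraph.mem_neighborSet, hi]
    simp
  -- Two disjoint pairs of cyclically consecutive indices in `Fin 4` must be complementary.
  have hij : j = i + 2 := by
    have hno : ∀ k, ¬ ((k = i ∨ k = i + 1) ∧ (k = j ∨ k = j + 1)) := by
      rintro k ⟨hk, hk'⟩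
      exact hvw (T.leaf_adj_unique ((hadjv k).2 hk).symm ((hadjw k).2 hk').symm)
    revert hno
    clear * -
    revert i j
    decide
  subst hij
  have hll := leaf_not_adj_leaf (T := T) fun k => by
    rcases (by decide : ∀ i k : Fin 4, (k = i ∨ k = i + 1) ∨ (k = i + 2 ∨ k = i + 2 + 1)) i k with
      h | h
    · exact ⟨v, hv, ((hadjv k).2 h).symm⟩
    · exact ⟨w, hw, ((hadjw k).2 h).symm⟩
  let e : Fin 4 ⊕ Bool → T.V := Sum.elim T.leaf fun b => if b then w else v
  have he : Function.Bijective e := by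
    constructor
    · rintro (k | _ | _) (l | _ | _) h
      · exact congrArg Sum.inl (T.leaf_injective h)
      · exact absurd h (hlv k)
      · exact absurd h (hlw k)
      · exact absurd h.symm (hlv l)
      · rfl
      · exact absurd h hvw
      · exact absurd h.symm (hlw l)
      · exact absurd h.symm hvw
      · rfl
    · intro u
      by_cases hu : T.IsInternal u
      · rcases huniq u hu with rfl | rfl
        · exact ⟨.inr false, rfl⟩
        · exact ⟨.inr true, rfl⟩
      · obtain ⟨k, hk⟩ := eq_leaf_of_not_isInternal hu
        exact ⟨.inl k, hk⟩
  have d1 : ∀ i k : Fin 4, (k = i ∨ k = i + 1) ↔ twoNodeAdj i (.inr false) (.inl k) = true := by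
    decide
  have d2 : ∀ i k : Fin 4, (k = i + 2 ∨ k = i + 2 + 1) ↔
      twoNodeAdj i (.inr true) (.inl k) = true := by
    decide
  have d3 : ∀ (i : Fin 4) (x y : Fin 4 ⊕ Bool), twoNodeAdj i x y = twoNodeAdj i y x := by decide
  refine ⟨i, ⟨⟨⟨Equiv.ofBijective e he, ?_⟩, fun i => rfl, ?_⟩⟩⟩
  · rintro (k | _ | _) (l | _ | _)
    · exact iff_of_false (hll k l) (by simp [twoNodeTree, twoNodeAdj])
    · change T.graph.Adj (T.leaf k) v ↔ twoNodeAdj i _ _ = true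
      rw [T.graph.adj_comm, d3, ← d1, hadjv]
    · change T.graph.Adj (T.leaf k) w ↔ twoNodeAdj i _ _ = true
      rw [T.graph.adj_comm, d3, ← d2, hadjw]
    · change T.graph.Adj v (T.leaf l) ↔ twoNodeAdj i _ _ = true
      rw [← d1, hadjv]
    · exact iff_of_false (T.graph.loopless.irrefl v) (by simp [twoNodeTree, twoNodeAdj])
    · exact iff_of_true hvw' (by simp [twoNodeTree, twoNodeAdj])
    · change T.graph.Adj w (T.leaf l) ↔ twoNodeAdj i _ _ = true
      rw [← d2, hadjw]
    · exact iff_of_true hvw'.symm (by simp [twoNodeTree, twoNodeAdj])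
    · exact iff_of_false (T.graph.loopless.irrefl w) (by simp [twoNodeTree, twoNodeAdj])
  · intro x y hxy
    change e (twoNodeNext i x y) = T.next (e x) (e y)
    change twoNodeAdj i x y = true at hxy
    rcases x with k | _ | _
    · have hadj : T.graph.Adj (T.leaf k) (e y) := by
        rcases y with l | _ | _
        · simp [twoNodeAdj] at hxy
        · rw [d3, ← d1, ← hadjv] at hxy
          exact hxy.symm
        · rw [d3, ← d2, ← hadjw] at hxy
          exact hxy.symm
      exact (T.next_leaf hadj).symm
    · rcases y with l | _ | _
      · rw [← d1] at hxy
        change _ = T.next v (T.leaf l)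
        rcases hxy with rfl | rfl
        · rw [i1]
          simp [twoNodeNext, e]
        · rw [i2]
          rw [(by decide : ∀ i : Fin 4, twoNodeNext i (.inr false) (.inl (i + 1)) = .inr true)]
          rfl
      · simp [twoNodeAdj] at hxy
      · exact i3.symm
    · rcases y with l | _ | _
      · rw [← d2] at hxy
        change _ = T.next w (T.leaf l)
        rcases hxy with rfl | rfl
        · rw [j1]
          simp [twoNodeNext, e]
        · rw [j2]
          rw [(by decide : ∀ i : Fin 4,
            twoNodeNext i (.inr true) (.inl (i + 2 + 1)) = .inr false)]
          rfl
      · exact j3.symm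
      · simp [twoNodeAdj] at hxy

/-- The classification of ribbon trees with four exterior vertices. -/
theorem classification : Nonempty (corolla.Iso T) ∨ ∃ i, Nonempty ((twoNodeTree i).Iso T) := by
  rcases T.internal_cases with ⟨v, h1, h2, h3⟩ | ⟨v, w, h1, h2, h3, h4, h5, h6⟩
  · exact .inl (T.corolla_iso_of_internal h1 h2 h3)
  · exact .inr (T.twoNodeTree_iso_of_internal h1 h2 h3 h4 h5 h6)

end RibbonTree

/-- Exchanging the interior vertices. -/
def twoNodeSwap (i : Fin 4) : (twoNodeTree i).Iso (twoNodeTree (i + 2)) where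
  toGraphIso :=
    { toFun := Sum.map id (!·)
      invFun := Sum.map id (!·)
      left_inv := by rintro (k | _ | _) <;> rfl
      right_inv := by rintro (k | _ | _) <;> rfl
      map_rel_iff' := by
        have : ∀ (i : Fin 4) (x y : Fin 4 ⊕ Bool), twoNodeAdj (i + 2) (Sum.map id (!·) x)
          (Sum.map id (!·) y) = true ↔ twoNodeAdj i x y = true := by decide
        intro x y
        exact this i x y }
  map_leaf _ := rfl
  map_next := by
    have : ∀ (i : Fin 4) (x y : Fin 4 ⊕ Bool), twoNodeAdj i x y = true →
        Sum.map id (!·) (twoNodeNext i x y) = twoNodeNext (i + 2) (Sum.map id (!·) x)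
          (Sum.map id (!·) y) := by decide
    intro x y h
    exact this i x y h

namespace RibbonTree

/-- Exchanging the interior vertices identifies the types j and j + 2, so only the two ways of
pairing neighbouring leaves remain, and they may be named relative to a given i. -/
theorem classification_relative (T : RibbonTree 4) (i : Fin 4) : Nonempty (corolla.Iso T) ∨
    Nonempty ((twoNodeTree i).Iso T) ∨ Nonempty ((twoNodeTree (i + 1)).Iso T) := by
  rcases T.classification with h | ⟨j, ⟨φ⟩⟩
  · exact .inl h
  have hj : (j = i ∨ j + 2 = i) ∨ (j = i + 1 ∨ j + 2 = i + 1) :=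
    (by decide : ∀ i j : Fin 4, (j = i ∨ j + 2 = i) ∨ (j = i + 1 ∨ j + 2 = i + 1)) i j
  rcases hj with (rfl | rfl) | (rfl | h)
  · exact .inr (.inl ⟨φ⟩)
  · exact .inr (.inl ⟨(twoNodeSwap j).symm.trans φ⟩)
  · exact .inr (.inr ⟨φ⟩)
  · rw [← h]
    exact .inr (.inr ⟨(twoNodeSwap j).symm.trans φ⟩)

end RibbonTree

/-! ### The scalar linear gradient flow -/

/-- The integral of `exp (-α s)` over `[0, t]`. -/
noncomputable def expIntegral (α t : ℝ) : ℝ := if α = 0 then t else (1 - Real.exp (-(α * t))) / α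

/-- This identity holds for α = 0 too, so parallel lines need no separate treatment in most of the
computations with the flow. -/
theorem one_sub_mul_expIntegral (α t : ℝ) : 1 - α * expIntegral α t = Real.exp (-(α * t)) := by
  unfold expIntegral
  split_ifs with h
  · simp [h]
  · field_simp
    ring

@[simp] theorem expIntegral_zero (α : ℝ) : expIntegral α 0 = 0 := by
  simp [expIntegral]

theorem hasDerivAt_expIntegral (α t : ℝ) :
    HasDerivAt (expIntegral α) (Real.exp (-(α * t))) t := by
  by_cases h : α = 0
  · have e : expIntegral α = id := by
      funext t
      simp [expIntegral, h]
    rw [e, h]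
    simpa using hasDerivAt_id t
  · have e : expIntegral α = fun t => (1 - Real.exp (-(α * t))) / α := by
      funext t
      simp [expIntegral, h]
    rw [e]
    have h1 : HasDerivAt (fun t : ℝ => -(α * t)) (-α) t := by
      simpa using ((hasDerivAt_id t).const_mul α).fun_neg
    refine ((h1.exp.const_sub 1).div_const α).congr_deriv ?_
    field_simp

theorem strictMono_expIntegral (α : ℝ) : StrictMono (expIntegral α) :=
  strictMono_of_hasDerivAt_pos (hasDerivAt_expIntegral α) fun _ => Real.exp_pos _

theorem expIntegral_pos (α : ℝ) {t : ℝ} (ht : 0 < t) : 0 < expIntegral α t := by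
  simpa using strictMono_expIntegral α ht

theorem expIntegral_neg (α t : ℝ) : expIntegral (-α) t = Real.exp (α * t) * expIntegral α t := by
  unfold expIntegral
  by_cases h : α = 0
  · simp [h]
  · have e : Real.exp (α * t) * Real.exp (-(α * t)) = 1 := by
      rw [← Real.exp_add]
      simp
    simp only [h, if_false, neg_eq_zero]
    field_simp
    rw [mul_sub, e]
    ring

/-- The solution of `y' = -(α y + β)` with initial value `c`. -/
noncomputable def linearFlow (α β c t : ℝ) : ℝ := c - (α * c + β) * expIntegral α t

@[simp] theorem linearFlow_zero (α β c : ℝ) : linearFlow α β c 0 = c := by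
  simp [linearFlow]

theorem linearFlow_rate (α β c t : ℝ) :
    α * linearFlow α β c t + β = (α * c + β) * Real.exp (-(α * t)) := by
  rw [← one_sub_mul_expIntegral, linearFlow]
  ring

theorem hasDerivAt_linearFlow (α β c t : ℝ) :
    HasDerivAt (linearFlow α β c) (-(α * linearFlow α β c t + β)) t := by
  rw [linearFlow_rate, ← neg_mul]
  exact (((hasDerivAt_expIntegral α t).const_mul (α * c + β)).const_sub c).congr_deriv (by ring)

/-- Uniqueness by an integrating factor: the difference of two solutions times exp(αt) has zero
derivative. An arbitrary convex set of times covers the half-line of an exterior edge and the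
interval of an interior one. -/
theorem eq_linearFlow {S : Set ℝ} (hS : Convex ℝ S) (h0 : (0 : ℝ) ∈ S) {α β : ℝ} {y : ℝ → ℝ}
    (hy : ∀ t ∈ S, HasDerivWithinAt y (-(α * y t + β)) S t) {t : ℝ} (ht : t ∈ S) :
    y t = linearFlow α β (y 0) t := by
  have hexp : ∀ t, HasDerivAt (fun t : ℝ => Real.exp (α * t)) (Real.exp (α * t) * α) t := by
    intro t
    have h1 : HasDerivAt (fun t : ℝ => α * t) α t := by
      simpa using (hasDerivAt_id t).const_mul α
    exact h1.exp
  have hz : ∀ t ∈ S, HasDerivWithinAt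
      (fun t => (y t - linearFlow α β (y 0) t) * Real.exp (α * t)) 0 S t := by
    intro t ht
    refine (((hy t ht).sub (hasDerivAt_linearFlow α β (y 0) t).hasDerivWithinAt).mul
      (hexp t).hasDerivWithinAt).congr_deriv ?_
    simp only [Pi.sub_apply]
    ring
  have := hS.norm_image_sub_le_of_norm_hasDerivWithin_le (C := 0) hz (by simp) h0 ht
  simp only [linearFlow_zero, sub_self, zero_mul, sub_zero, norm_le_zero_iff, mul_eq_zero,
    Real.exp_ne_zero, or_false] at this
  linarith

/-- Time reversal. -/
theorem linearFlow_reverse {α β c c' l : ℝ} (h : c' = linearFlow α β c l) :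
    c = linearFlow (-α) (-β) c' l := by
  have h1 := linearFlow_rate α β c l
  rw [← h] at h1
  have e : Real.exp (α * l) * Real.exp (-(α * l)) = 1 := by
    rw [← Real.exp_add]
    simp
  rw [linearFlow, expIntegral_neg]
  rw [linearFlow] at h
  have h2 : -α * c' + -β = -((α * c + β) * Real.exp (-(α * l))) := by
    rw [← h1]
    ring
  rw [h2]
  linear_combination -h - (α * c + β) * expIntegral α l * e

/-- A flow line with non-zero velocity of the right sign reaches its target. -/
theorem exists_linearFlow {α β c₀ c₁ : ℝ} (hc : c₁ < c₀) (h0 : 0 < α * c₀ + β)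
    (h1 : 0 < α * c₁ + β) : ∃ l > 0, c₁ = linearFlow α β c₀ l := by
  suffices h : ∃ l, c₁ = linearFlow α β c₀ l by
    obtain ⟨l, hl⟩ := h
    refine ⟨l, ?_, hl⟩
    rw [linearFlow] at hl
    rw [gt_iff_lt, ← (strictMono_expIntegral α).lt_iff_lt, expIntegral_zero]
    have : 0 < (α * c₀ + β) * expIntegral α l := by linarith
    exact pos_of_mul_pos_right this h0.le
  by_cases hα : α = 0
  · refine ⟨(c₀ - c₁) / β, ?_⟩
    have hβ : β ≠ 0 := by
      rw [hα] at h0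
      linarith
    simp [linearFlow, expIntegral, hα]
    field_simp
    ring
  -- By `linearFlow_rate` the speed decays by the factor exp(-αl), which has to be the quotient of
  -- the speeds at `c₁` and `c₀`.
  · refine ⟨-Real.log ((α * c₁ + β) / (α * c₀ + β)) / α, ?_⟩
    have e : -(α * (-Real.log ((α * c₁ + β) / (α * c₀ + β)) / α)) =
        Real.log ((α * c₁ + β) / (α * c₀ + β)) := by
      field_simp
    rw [linearFlow, expIntegral, if_neg hα, e, Real.exp_log (div_pos h1 h0)]
    have h2 : (α * c₀ + β) * ((α * c₁ + β) / (α * c₀ + β)) = α * c₁ + β :=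
      mul_div_cancel₀ _ h0.ne'
    rw [← mul_div_assoc, mul_sub, h2, eq_sub_iff_add_eq, ← eq_sub_iff_add_eq', div_eq_iff hα]
    ring

theorem deriv_sub_of_affine {f g : ℝ → ℝ} {a b a' b' : ℝ} (hf : ∀ t, HasDerivAt f (a * t + b) t)
    (hg : ∀ t, HasDerivAt g (a' * t + b') t) (y : ℝ) :
    deriv (fun y => f y - g y) y = (a - a') * y + (b - b') := by
  rw [((hf y).fun_sub (hg y)).deriv]
  ring

/-! ### Gradient trees of functions with affine differential -/

namespace GradientTree

variable {f : Fin 4 → ℝ → ℝ} {p : Fin 4 → ℝ} {a b : Fin 4 → ℝ}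

/-- The flow along an interior edge of a gradient tree. -/
theorem int_eq (hf : ∀ i t, HasDerivAt (f i) (a i * t + b i) t) (Γ : GradientTree f p)
    {u v : Γ.tree.V} (h : Γ.tree.IsInternalEdge u v) {t : ℝ} (ht : t ∈ Icc 0 (Γ.len s(u, v))) :
    Γ.int u v t = linearFlow (a (Γ.tree.region u v) - a (Γ.tree.region v u))
      (b (Γ.tree.region u v) - b (Γ.tree.region v u)) (Γ.node u) t := by
  have hl := Γ.len_pos u v h
  have := eq_linearFlow (convex_Icc 0 _) (left_mem_Icc.2 hl.le)
    (fun t ht => by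
      have := Γ.int_deriv u v h t ht
      rwa [deriv_sub_of_affine (hf _) (hf _)] at this) ht
  rwa [Γ.int_zero u v h] at this

theorem node_eq (hf : ∀ i t, HasDerivAt (f i) (a i * t + b i) t) (Γ : GradientTree f p)
    {u v : Γ.tree.V} (h : Γ.tree.IsInternalEdge u v) :
    Γ.node v = linearFlow (a (Γ.tree.region u v) - a (Γ.tree.region v u))
      (b (Γ.tree.region u v) - b (Γ.tree.region v u)) (Γ.node u) (Γ.len s(u, v)) := by
  rw [← Γ.int_len u v h]
  exact Γ.int_eq hf h (right_mem_Icc.2 (Γ.len_pos u v h).le)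

/-- The flow along an exterior edge of a gradient tree. -/
theorem ext_eq (hf : ∀ i t, HasDerivAt (f i) (a i * t + b i) t) (Γ : GradientTree f p) {i : Fin 4}
    {u : Γ.tree.V} (h : Γ.tree.graph.Adj (Γ.tree.leaf i) u) {t : ℝ} (ht : t ∈ Iic (0 : ℝ)) :
    Γ.ext i t = linearFlow (a (i + 1) - a i) (b (i + 1) - b i) (Γ.node u) t := by
  have := eq_linearFlow (convex_Iic 0) (mem_Iic.2 le_rfl)
    (fun t ht => by
      have := Γ.ext_deriv i t ht
      rwa [deriv_sub_of_affine (hf _) (hf _)] at this) ht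
  rwa [Γ.ext_zero i u h] at this

theorem linearFlow_crit {α β c q t : ℝ} (hq : α * q + β = 0) :
    linearFlow α β c t = q + (c - q) * Real.exp (-(α * t)) := by
  rw [← one_sub_mul_expIntegral, linearFlow]
  linear_combination -expIntegral α t * hq

/-- At a minimum of `f (i + 1) - f i` the exterior edge is constant. -/
theorem node_eq_of_lt (hf : ∀ i t, HasDerivAt (f i) (a i * t + b i) t)
    (hp : ∀ i, a (i + 1) * p i + b (i + 1) = a i * p i + b i) (Γ : GradientTree f p) {i : Fin 4}
    {u : Γ.tree.V} (h : Γ.tree.graph.Adj (Γ.tree.leaf i) u) (hi : a i < a (i + 1)) :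
    Γ.node u = p i := by
  have hα : 0 < a (i + 1) - a i := sub_pos.2 hi
  -- Here (y - p)·exp(αt) is conserved; as t → -∞ both factors tend to 0 because α > 0, so the
  -- conserved value vanishes.
  have h1 : ∀ t ∈ Iic (0 : ℝ), (Γ.ext i t - p i) * Real.exp ((a (i + 1) - a i) * t) =
      Γ.node u - p i := by
    intro t ht
    have e : Real.exp (-((a (i + 1) - a i) * t)) * Real.exp ((a (i + 1) - a i) * t) = 1 := by
      rw [← Real.exp_add]
      simp
    rw [Γ.ext_eq hf h ht, linearFlow_crit (q := p i) (by linarith [hp i])]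
    linear_combination (Γ.node u - p i) * e
  have h2 : Tendsto (fun t => (Γ.ext i t - p i) * Real.exp ((a (i + 1) - a i) * t)) atBot
      (𝓝 ((p i - p i) * 0)) :=
    ((Γ.ext_tendsto i).sub_const _).mul
      (Real.tendsto_exp_atBot.comp (tendsto_id.const_mul_atBot hα))
  have h3 : Tendsto (fun t => (Γ.ext i t - p i) * Real.exp ((a (i + 1) - a i) * t)) atBot
      (𝓝 (Γ.node u - p i)) := by
    refine tendsto_const_nhds.congr' ?_
    filter_upwards [Iic_mem_atBot 0] with t ht using (h1 t ht).symm
  have := tendsto_nhds_unique h2 h3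
  linarith

/-- A gradient tree is given by its values at the vertices. -/
theorem exists_of_node (hf : ∀ i t, HasDerivAt (f i) (a i * t + b i) t)
    (hp : ∀ i, a (i + 1) * p i + b (i + 1) = a i * p i + b i) (T : RibbonTree 4)
    (node : T.V → ℝ) (l : ℝ) (hl : 0 < l) (hleaf : ∀ i, node (T.leaf i) = p i)
    (hext : ∀ i u, T.graph.Adj (T.leaf i) u → node u = p i ∨ a (i + 1) < a i)
    (hint : ∀ u v, T.IsInternalEdge u v → node v =
      linearFlow (a (T.region u v) - a (T.region v u)) (b (T.region u v) - b (T.region v u))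
        (node u) l) :
    ∃ Γ : GradientTree f p, ∃ φ : T.Iso Γ.tree, ∀ v, Γ.node (φ.toGraphIso v) = node v := by
  choose nb hnb using T.exists_leaf_neighbor
  have hnb' : ∀ i, T.graph.Adj (T.leaf i) (nb i) := fun i => by
    rw [← SimpleGraph.mem_neighborSet, hnb]
    rfl
  let Γ : GradientTree f p :=
    { tree := T
      -- One number suffices because a tree with four leaves has at most one interior edge.
      len := fun _ => l
      len_pos := fun _ _ _ => hl
      node := node
      node_leaf := hleaf
      ext := fun i t => linearFlow (a (i + 1) - a i) (b (i + 1) - b i) (node (nb i)) t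
      ext_tendsto := ?_
      ext_zero := ?_
      ext_deriv := ?_
      int := fun u v t => linearFlow (a (T.region u v) - a (T.region v u))
        (b (T.region u v) - b (T.region v u)) (node u) t
      int_zero := fun u v _ => linearFlow_zero _ _ _
      int_len := fun u v h => (hint u v h).symm
      int_deriv := ?_ }
  · exact ⟨Γ, ⟨SimpleGraph.Iso.refl, fun _ => rfl, fun _ _ _ => rfl⟩, fun _ => rfl⟩
  · intro i
    have e : ∀ t, linearFlow (a (i + 1) - a i) (b (i + 1) - b i) (node (nb i)) t =
        p i + (node (nb i) - p i) * Real.exp (-((a (i + 1) - a i) * t)) := fun t =>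
      linearFlow_crit (by linarith [hp i])
    simp only [e]
    rcases hext i _ (hnb' i) with h | h
    · simp [h]
    · have h1 : Tendsto (fun t : ℝ => -((a (i + 1) - a i) * t)) atBot atBot := by
        have := tendsto_id.const_mul_atBot (sub_pos.2 h)
        refine this.congr fun t => ?_
        simp only [id]
        ring
      simpa using ((Real.tendsto_exp_atBot.comp h1).const_mul (node (nb i) - p i)).const_add (p i)
  · intro i u hu
    rw [linearFlow_zero, T.leaf_adj_unique hu (hnb' i)]
  · intro i t ht
    rw [deriv_sub_of_affine (hf _) (hf _)]
    exact (hasDerivAt_linearFlow _ _ _ t).hasDerivWithinAt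
  · intro u v h t ht
    rw [deriv_sub_of_affine (hf _) (hf _)]
    exact (hasDerivAt_linearFlow _ _ _ t).hasDerivWithinAt

/-- Gradient trees with isomorphic ribbon trees and the same values at the vertices are the same,
when no interior edge is constant. -/
theorem nonempty_iso (hf : ∀ i t, HasDerivAt (f i) (a i * t + b i) t) (A B : GradientTree f p)
    (φ : A.tree.Iso B.tree)
    (hedge : ∀ u v, A.tree.IsInternalEdge u v →
      B.tree.region (φ.toGraphIso u) (φ.toGraphIso v) = A.tree.region u v ∧
      B.tree.region (φ.toGraphIso v) (φ.toGraphIso u) = A.tree.region v u ∧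
      (a (A.tree.region u v) - a (A.tree.region v u)) * A.node u +
        (b (A.tree.region u v) - b (A.tree.region v u)) ≠ 0)
    (hnode : ∀ v, A.tree.IsInternal v → B.node (φ.toGraphIso v) = A.node v) :
    Nonempty (A.Iso B) := by
  have hnode' : ∀ v, B.node (φ.toGraphIso v) = A.node v := by
    intro v
    by_cases hv : A.tree.IsInternal v
    · exact hnode v hv
    · obtain ⟨i, rfl⟩ := RibbonTree.eq_leaf_of_not_isInternal hv
      rw [φ.map_leaf, A.node_leaf, B.node_leaf]
  have hE : ∀ u v, A.tree.IsInternalEdge u v →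
      B.tree.IsInternalEdge (φ.toGraphIso u) (φ.toGraphIso v) := by
    rintro u v h
    obtain ⟨h1, h2, -⟩ := hedge u v h
    refine ⟨φ.toGraphIso.map_adj_iff.2 h.1, φ.isInternal h.2.1, φ.isInternal h.2.2.1, ?_⟩
    rw [h1, h2]
    exact h.2.2.2
  have hlen : ∀ u v, A.tree.IsInternalEdge u v →
      B.len s(φ.toGraphIso u, φ.toGraphIso v) = A.len s(u, v) := by
    intro u v h
    obtain ⟨h1, h2, h3⟩ := hedge u v h
    have eA := A.node_eq hf h
    have eB := B.node_eq hf (hE u v h)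
    rw [h1, h2, hnode', hnode', eA, linearFlow, linearFlow] at eB
    -- The initial speed is not zero, so the displacement determines the length of the edge.
    apply (strictMono_expIntegral (a (A.tree.region u v) - a (A.tree.region v u))).injective
    exact mul_left_cancel₀ h3 (by linarith)
  refine ⟨⟨φ, hlen, hnode', ?_, ?_⟩⟩
  · intro i t ht
    obtain ⟨u, hu⟩ := A.tree.exists_leaf_neighbor i
    have hu' : A.tree.graph.Adj (A.tree.leaf i) u := by
      rw [← SimpleGraph.mem_neighborSet, hu]
      rfl
    have hu'' : B.tree.graph.Adj (B.tree.leaf i) (φ.toGraphIso u) := by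
      rw [← φ.map_leaf]
      exact φ.toGraphIso.map_adj_iff.2 hu'
    rw [A.ext_eq hf hu' ht, B.ext_eq hf hu'' ht, hnode']
  · intro u v h t ht
    obtain ⟨h1, h2, h3⟩ := hedge u v h
    rw [A.int_eq hf h ht, B.int_eq hf (hE u v h) (by rwa [hlen u v h]), h1, h2, hnode']

end GradientTree

/-! ### The interior edge and its two neighbouring components -/

namespace RibbonTree

theorem Iso.symm_trans_apply {k : ℕ} [NeZero k] {T T' T'' : RibbonTree k} (φ : T.Iso T')
    (ψ : T.Iso T'') (v : T.V) : (φ.symm.trans ψ).toGraphIso (φ.toGraphIso v) = ψ.toGraphIso v :=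
  congrArg ψ.toGraphIso (φ.toGraphIso.symm_apply_apply v)

theorem isInternal_twoNodeTree (i : Fin 4) (c : Bool) :
    (twoNodeTree i).IsInternal (.inr c : Fin 4 ⊕ Bool) := by
  rintro ⟨j, hj⟩
  cases hj

theorem Iso.adj_leaf {k : ℕ} [NeZero k] {T T' : RibbonTree k} (φ : T.Iso T') {i : Fin k} {v : T.V}
    (h : T.graph.Adj (T.leaf i) v) : T'.graph.Adj (T'.leaf i) (φ.toGraphIso v) := by
  rw [← φ.map_leaf]
  exact φ.toGraphIso.map_adj_iff.2 h

/-- The components on the two sides of the interior edge. -/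
theorem region_twoNodeTree {T : RibbonTree 4} {i : Fin 4} (φ : (twoNodeTree i).Iso T) :
    T.region (φ.toGraphIso (.inr false : Fin 4 ⊕ Bool))
      (φ.toGraphIso (.inr true : Fin 4 ⊕ Bool)) = i + 2 ∧
    T.region (φ.toGraphIso (.inr true : Fin 4 ⊕ Bool))
      (φ.toGraphIso (.inr false : Fin 4 ⊕ Bool)) = i := by
  -- Isomorphisms do not mention `region`. It is recovered by arriving along the interior edge and
  -- turning right: the next edge leads to a leaf, whose number names the component on the right.
  have key : ∀ (c : Bool) (k : Fin 4),
      (twoNodeTree i).next (.inr c : Fin 4 ⊕ Bool) (.inr (!c) : Fin 4 ⊕ Bool) =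
        (twoNodeTree i).leaf k →
      T.region (φ.toGraphIso (.inr (!c) : Fin 4 ⊕ Bool))
        (φ.toGraphIso (.inr c : Fin 4 ⊕ Bool)) = k := by
    intro c k hk
    have hadj : (twoNodeTree i).graph.Adj (.inr c : Fin 4 ⊕ Bool) (.inr (!c) : Fin 4 ⊕ Bool) := by
      cases c <;> rfl
    have hadj' := φ.toGraphIso.map_adj_iff.2 hadj
    have hint := φ.isInternal (isInternal_twoNodeTree i c)
    rw [← T.region_turn _ _ hadj'.symm hint]
    have hn := T.next_adj _ _ hadj'
    rw [← φ.map_next _ _ hadj, hk, φ.map_leaf] at hn ⊢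
    exact T.region_to_leaf k _ hn
  exact ⟨key true (i + 2) rfl, key false i rfl⟩

/-- The interior edges of a tree of the type `twoNodeTree i`. -/
theorem isInternalEdge_twoNodeTree {T : RibbonTree 4} {i : Fin 4} (φ : (twoNodeTree i).Iso T)
    {u v : T.V} (h : T.IsInternalEdge u v) :
    ∃ c : Bool, u = φ.toGraphIso (.inr c : Fin 4 ⊕ Bool) ∧
      v = φ.toGraphIso (.inr (!c) : Fin 4 ⊕ Bool) := by
  have hint : ∀ u, T.IsInternal u → ∃ c : Bool, u = φ.toGraphIso (.inr c : Fin 4 ⊕ Bool) := by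
    intro u hu
    obtain ⟨x, rfl⟩ := φ.toGraphIso.surjective u
    rcases x with k | c
    · exact absurd ⟨k, (φ.map_leaf k).symm⟩ hu
    · exact ⟨c, rfl⟩
  obtain ⟨hadj, hu, hv, -⟩ := h
  obtain ⟨c, rfl⟩ := hint u hu
  obtain ⟨d, rfl⟩ := hint v hv
  refine ⟨c, rfl, ?_⟩
  have hne : c ≠ d := by
    rintro rfl
    exact T.graph.loopless.irrefl _ hadj
  rw [Bool.eq_not.2 hne.symm]

theorem not_isInternalEdge_corolla {T : RibbonTree 4} (φ : corolla.Iso T) (u v : T.V) :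
    ¬ T.IsInternalEdge u v := by
  have hint : ∀ u, T.IsInternal u → u = φ.toGraphIso (none : Option (Fin 4)) := by
    intro u hu
    obtain ⟨x, rfl⟩ := φ.toGraphIso.surjective u
    rcases x with _ | k
    · rfl
    · exact absurd ⟨k, (φ.map_leaf k).symm⟩ hu
  rintro ⟨hadj, hu, hv, -⟩
  rw [hint u hu, hint v hv] at hadj
  exact T.graph.loopless.irrefl _ hadj

end RibbonTree

/-! ### Existence and uniqueness of the gradient tree -/

section Moduli

variable {f : Fin 4 → ℝ → ℝ} {a b p : Fin 4 → ℝ}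

/-- What the flow along the interior edge tells about a gradient tree of type `twoNodeTree i`. -/
theorem GradientTree.twoNode_flow (hf : ∀ i t, HasDerivAt (f i) (a i * t + b i) t)
    (Γ : GradientTree f p) {i : Fin 4} (φ : (twoNodeTree i).Iso Γ.tree) :
    ∃ l > 0, Γ.node (φ.toGraphIso (.inr true : Fin 4 ⊕ Bool)) =
      linearFlow (a (i + 2) - a i) (b (i + 2) - b i)
        (Γ.node (φ.toGraphIso (.inr false : Fin 4 ⊕ Bool))) l := by
  obtain ⟨r1, r2⟩ := RibbonTree.region_twoNodeTree φ
  have hint := fun c => φ.isInternal (RibbonTree.isInternal_twoNodeTree i c)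
  have hadj : Γ.tree.graph.Adj (φ.toGraphIso (.inr false : Fin 4 ⊕ Bool))
      (φ.toGraphIso (.inr true : Fin 4 ⊕ Bool)) := φ.toGraphIso.map_adj_iff.2 rfl
  have hne : i ≠ i + 2 := by simp
  -- The edge is oriented by comparing i and i + 2 as elements of `Fin 4`, without regard to
  -- cyclicity. For the opposite orientation, reversing time and the sign of the gradient gives the
  -- same flow relation.
  rcases lt_or_gt_of_ne hne with h | h
  · have hE : Γ.tree.IsInternalEdge (φ.toGraphIso (.inr false : Fin 4 ⊕ Bool))
      (φ.toGraphIso (.inr true : Fin 4 ⊕ Bool)) := ⟨hadj, hint _, hint _, by rwa [r1, r2]⟩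
    have := Γ.node_eq hf hE
    rw [r1, r2] at this
    exact ⟨_, Γ.len_pos _ _ hE, this⟩
  · have hE : Γ.tree.IsInternalEdge (φ.toGraphIso (.inr true : Fin 4 ⊕ Bool))
      (φ.toGraphIso (.inr false : Fin 4 ⊕ Bool)) := ⟨hadj.symm, hint _, hint _, by rwa [r1, r2]⟩
    have := linearFlow_reverse (Γ.node_eq hf hE)
    rw [r1, r2, neg_sub, neg_sub] at this
    exact ⟨_, Γ.len_pos _ _ hE, this⟩

/-- Each leaf at a minimum pins the interior vertex next to it, by `node_eq_of_lt`. -/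
theorem GradientTree.twoNode_leaves (hf : ∀ i t, HasDerivAt (f i) (a i * t + b i) t)
    (h : AffineQuad a b p) (Γ : GradientTree f p) {i : Fin 4} (φ : (twoNodeTree i).Iso Γ.tree) :
    ((a i < a (i + 1) → Γ.node (φ.toGraphIso (.inr false : Fin 4 ⊕ Bool)) = p i) ∧
      (a (i + 1) < a (i + 2) → Γ.node (φ.toGraphIso (.inr false : Fin 4 ⊕ Bool)) = p (i + 1))) ∧
    ((a (i + 2) < a (i + 3) → Γ.node (φ.toGraphIso (.inr true : Fin 4 ⊕ Bool)) = p (i + 2)) ∧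
      (a (i + 3) < a i → Γ.node (φ.toGraphIso (.inr true : Fin 4 ⊕ Bool)) = p (i + 3))) := by
  have key : ∀ (k : Fin 4) (c : Bool), twoNodeAdj i (.inl k) (.inr c) = true →
      a k < a (k + 1) → Γ.node (φ.toGraphIso (.inr c : Fin 4 ⊕ Bool)) = p k := by
    intro k c hkc hk
    exact Γ.node_eq_of_lt hf h.crit (φ.adj_leaf (v := (.inr c : Fin 4 ⊕ Bool)) hkc) hk
  refine ⟨⟨key i false ?_, fun hk => key (i + 1) false ?_ ?_⟩,
    ⟨fun hk => key (i + 2) true ?_ ?_, fun hk => key (i + 3) true ?_ ?_⟩⟩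
  · exact (by decide : ∀ i : Fin 4, twoNodeAdj i (.inl i) (.inr false) = true) i
  · exact (by decide : ∀ i : Fin 4, twoNodeAdj i (.inl (i + 1)) (.inr false) = true) i
  · simpa only [add_assoc, Fin.reduceAdd] using hk
  · exact (by decide : ∀ i : Fin 4, twoNodeAdj i (.inl (i + 2)) (.inr true) = true) i
  · simpa only [add_assoc, Fin.reduceAdd] using hk
  · exact (by decide : ∀ i : Fin 4, twoNodeAdj i (.inl (i + 3)) (.inr true) = true) i
  · simpa only [add_assoc, Fin.reduceAdd, add_zero] using hk

theorem GradientTree.corolla_leaves (hf : ∀ i t, HasDerivAt (f i) (a i * t + b i) t)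
    (h : AffineQuad a b p) (Γ : GradientTree f p) (φ : corolla.Iso Γ.tree) (k : Fin 4)
    (hk : a k < a (k + 1)) : Γ.node (φ.toGraphIso (none : Option (Fin 4))) = p k := by
  refine Γ.node_eq_of_lt hf h.crit (φ.adj_leaf (v := (none : Option (Fin 4))) ?_) hk
  change (some k).isSome ≠ (none : Option (Fin 4)).isSome
  simp

theorem fin_four_cases (i k : Fin 4) : k = i ∨ k = i + 1 ∨ k = i + 2 ∨ k = i + 3 := by
  revert i k
  decide

/-- Two leaves pin the interior vertices at `c₀` and `c₁`, and the other two sit at maxima and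
adapt. The derivative of f_{i+2} - f_i is positive at both points, so the flow runs left from `c₀`
to `c₁` in a unique positive time. The corolla would need `c₀ = c₁`. -/
theorem AffineQuad.exists_gradientTree_of_isSeparated
    (hf : ∀ i t, HasDerivAt (f i) (a i * t + b i) t) (h : AffineQuad a b p) {i : Fin 4}
    (hi : IsSeparated p i) : ∃ Γ : GradientTree f p, (∀ Γ' : GradientTree f p, Nonempty (Γ'.Iso Γ)) ∧
      Nonempty ((twoNodeTree i).Iso Γ.tree) := by
  obtain ⟨c₀, c₁, hc, -, hF0, hF1, hright, hleft⟩ := h.separated_facts hi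
  obtain ⟨h20, h21, h30, h31⟩ := hi
  obtain ⟨e0, e1, e2, e3⟩ := h.crit_all i
  have hF0' : 0 < (a (i + 2) - a i) * c₀ + (b (i + 2) - b i) := by linarith
  have hF1' : 0 < (a (i + 2) - a i) * c₁ + (b (i + 2) - b i) := by linarith
  obtain ⟨l, hl, hflow⟩ := exists_linearFlow hc hF0' hF1'
  have hflow' := linearFlow_reverse hflow
  rw [neg_sub, neg_sub] at hflow'
  set node : Fin 4 ⊕ Bool → ℝ := Sum.elim p fun c => if c then c₁ else c₀ with hnode
  obtain ⟨Γ, ψ, hψ⟩ := GradientTree.exists_of_node hf h.crit (twoNodeTree i) node l hl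
    (fun k => rfl) (by
      rintro k (k' | c) hadj
      · cases hadj
      · change twoNodeAdj i (.inl k) (.inr c) = true at hadj
        have hcc : c = decide (k = i + 2 ∨ k = i + 3) := (beq_iff_eq.1 hadj).symm
        rcases fin_four_cases i k with rfl | rfl | rfl | rfl
        · have : c = false := hcc.trans ((by decide : ∀ k : Fin 4,
            decide (k = k + 2 ∨ k = k + 3) = false) _)
          subst this
          rcases hright with ⟨q1, q2, q3⟩ | ⟨q1, q2, q3⟩
          · exact .inl q1.symm
          · exact .inr q3
        · have : c = false := hcc.trans ((by decide : ∀ k : Fin 4,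
            decide (k + 1 = k + 2 ∨ k + 1 = k + 3) = false) _)
          subst this
          simp only [add_assoc, Fin.reduceAdd]
          rcases hright with ⟨q1, q2, q3⟩ | ⟨q1, q2, q3⟩
          · exact .inr q3
          · exact .inl q1.symm
        · have : c = true := hcc.trans (by simp)
          subst this
          simp only [add_assoc, Fin.reduceAdd]
          rcases hleft with ⟨q1, q2, q3⟩ | ⟨q1, q2, q3⟩
          · exact .inl q1.symm
          · exact .inr q3
        · have : c = true := hcc.trans (by simp)
          subst this
          simp only [add_assoc, Fin.reduceAdd, add_zero]
          rcases hleft with ⟨q1, q2, q3⟩ | ⟨q1, q2, q3⟩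
          · exact .inr q3
          · exact .inl q1.symm)
    (by
      intro u v huv
      obtain ⟨c, rfl, rfl⟩ := RibbonTree.isInternalEdge_twoNodeTree
        (⟨SimpleGraph.Iso.refl, fun _ => rfl, fun _ _ _ => rfl⟩ :
          (twoNodeTree i).Iso (twoNodeTree i)) huv
      cases c
      · exact hflow
      · exact hflow')
  refine ⟨Γ, fun Γ' => ?_, ⟨ψ⟩⟩
  rcases Γ'.tree.classification_relative i with ⟨⟨φ⟩⟩ | ⟨⟨φ⟩⟩ | ⟨⟨φ⟩⟩
  · exfalso
    have hk := Γ'.corolla_leaves hf h φ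
    have k0 := hk i
    have k1 := hk (i + 1)
    have k2 := hk (i + 2)
    have k3 := hk (i + 3)
    simp only [add_assoc, Fin.reduceAdd, add_zero] at k1 k2 k3
    rcases hright with ⟨q1, q2, -⟩ | ⟨q1, q2, -⟩ <;> rcases hleft with ⟨q3, q4, -⟩ | ⟨q3, q4, -⟩
    · linarith [k0 q2, k2 q4]
    · linarith [k0 q2, k3 q4]
    · linarith [k1 q2, k2 q4]
    · linarith [k1 q2, k3 q4]
  · have hφ : ∀ c : Bool, Γ'.node (φ.toGraphIso (.inr c : Fin 4 ⊕ Bool)) = node (.inr c) := by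
      obtain ⟨⟨k0, k1⟩, ⟨k2, k3⟩⟩ := Γ'.twoNode_leaves hf h φ
      rintro (_ | _)
      · rcases hright with ⟨q1, q2, -⟩ | ⟨q1, q2, -⟩
        · exact (k0 q2).trans q1
        · exact (k1 q2).trans q1
      · rcases hleft with ⟨q1, q2, -⟩ | ⟨q1, q2, -⟩
        · exact (k2 q2).trans q1
        · exact (k3 q2).trans q1
    obtain ⟨s1, s2⟩ := RibbonTree.region_twoNodeTree φ
    obtain ⟨t1, t2⟩ := RibbonTree.region_twoNodeTree ψ
    refine GradientTree.nonempty_iso hf Γ' Γ (φ.symm.trans ψ) ?_ ?_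
    · intro u v huv
      obtain ⟨c, rfl, rfl⟩ := RibbonTree.isInternalEdge_twoNodeTree φ huv
      have hs := φ.symm_trans_apply ψ
      cases c
      · refine ⟨(congrArg₂ _ (hs _) (hs _)).trans (t1.trans s1.symm),
          (congrArg₂ _ (hs _) (hs _)).trans (t2.trans s2.symm), ?_⟩
        simp only [Bool.not_false]
        rw [s1, s2, hφ]
        exact hF0'.ne'
      · refine ⟨(congrArg₂ _ (hs _) (hs _)).trans (t2.trans s2.symm),
          (congrArg₂ _ (hs _) (hs _)).trans (t1.trans s1.symm), ?_⟩
        simp only [Bool.not_true]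
        rw [s1, s2, hφ]
        have : (a i - a (i + 2)) * c₁ + (b i - b (i + 2)) < 0 := by linarith
        exact this.ne
    · intro v hv
      obtain ⟨x, rfl⟩ := φ.toGraphIso.surjective v
      rcases x with k | c
      · exact absurd ⟨k, (φ.map_leaf k).symm⟩ hv
      · exact (congrArg Γ.node (φ.symm_trans_apply ψ _)).trans ((hψ _).trans (hφ c).symm)
  · exfalso
    obtain ⟨⟨k0, k1⟩, ⟨k2, k3⟩⟩ := Γ'.twoNode_leaves hf h φ
    obtain ⟨l', hl', hfl⟩ := Γ'.twoNode_flow hf φ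
    simp only [add_assoc, Fin.reduceAdd, add_zero] at k0 k1 k2 k3 hfl
    have hE := expIntegral_pos (a (i + 3) - a (i + 1)) hl'
    rw [linearFlow] at hfl
    -- In the other pairing of leaves either both pins fall on one interior vertex, which would have
    -- two different positions, or the pins fall on different vertices and the flow from one starts
    -- in the direction away from the other.
    rcases hright with ⟨q1, q2, q2'⟩ | ⟨q1, q2, q2'⟩ <;>
      rcases hleft with ⟨q3, q4, q4'⟩ | ⟨q3, q4, q4'⟩
    · rw [k3 q2, k1 q4] at hfl
      have : 0 < (a (i + 3) - a (i + 1)) * p (i + 2) + (b (i + 3) - b (i + 1)) := by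
        nlinarith [mul_pos (sub_pos.2 q2') (sub_pos.2 h21)]
      nlinarith [mul_pos this hE]
    · linarith [k3 q2, k2 q4]
    · linarith [k0 q2, k1 q4]
    · rw [k0 q2, k2 q4] at hfl
      have : (a (i + 3) - a (i + 1)) * p (i + 1) + (b (i + 3) - b (i + 1)) < 0 := by
        nlinarith [mul_pos (sub_pos.2 q4') (sub_pos.2 h21)]
      nlinarith [mul_pos (neg_pos.2 this) hE]

/-- The minima at the leaves i and i + 2 have the same abscissa and pin the single interior vertex
there. In either two-node tree these leaves hang on different interior vertices, so the interior
edge would begin and end at this abscissa although the flow moves it off with nonzero speed. -/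
theorem AffineQuad.exists_gradientTree_of_isAligned
    (hf : ∀ i t, HasDerivAt (f i) (a i * t + b i) t) (h : AffineQuad a b p) {i : Fin 4}
    (hi : IsAligned p i) : ∃ Γ : GradientTree f p, (∀ Γ' : GradientTree f p, Nonempty (Γ'.Iso Γ)) ∧
      Nonempty (corolla.Iso Γ.tree) := by
  obtain ⟨⟨m0, m1, m2, m3⟩, hF, hF'⟩ := h.aligned_facts hi
  have h02 := hi.h02
  set node : Option (Fin 4) → ℝ := fun o => o.elim (p i) p with hnode
  obtain ⟨Γ, ψ, hψ⟩ := GradientTree.exists_of_node hf h.crit corolla node 1 one_pos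
    (fun k => rfl) (by
      rintro k (_ | k') hadj
      · change p i = p k ∨ _
        rcases fin_four_cases i k with rfl | rfl | rfl | rfl
        · exact .inl rfl
        · simp only [add_assoc, Fin.reduceAdd]
          exact .inr m1
        · exact .inl h02.symm
        · simp only [add_assoc, Fin.reduceAdd, add_zero]
          exact .inr m3
      · exact absurd rfl hadj)
    (fun u v huv => absurd huv (RibbonTree.not_isInternalEdge_corolla
      (⟨SimpleGraph.Iso.refl, fun _ => rfl, fun _ _ _ => rfl⟩ : corolla.Iso corolla) u v))
  refine ⟨Γ, fun Γ' => ?_, ⟨ψ⟩⟩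
  rcases Γ'.tree.classification_relative i with ⟨⟨φ⟩⟩ | ⟨⟨φ⟩⟩ | ⟨⟨φ⟩⟩
  · refine GradientTree.nonempty_iso hf Γ' Γ (φ.symm.trans ψ)
      (fun u v huv => absurd huv (RibbonTree.not_isInternalEdge_corolla φ u v)) ?_
    intro v hv
    obtain ⟨x, rfl⟩ := φ.toGraphIso.surjective v
    rcases x with _ | k
    · exact (congrArg Γ.node (φ.symm_trans_apply ψ _)).trans
        ((hψ _).trans (Γ'.corolla_leaves hf h φ i m0).symm)
    · exact absurd ⟨k, (φ.map_leaf k).symm⟩ hv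
  · exfalso
    obtain ⟨⟨k0, -⟩, ⟨k2, -⟩⟩ := Γ'.twoNode_leaves hf h φ
    obtain ⟨l, hl, hfl⟩ := Γ'.twoNode_flow hf φ
    have hE := expIntegral_pos (a (i + 2) - a i) hl
    rw [linearFlow, k0 m0, k2 m2, h02] at hfl
    have : 0 < (a (i + 2) - a i) * p i + (b (i + 2) - b i) := by linarith
    nlinarith [mul_pos this hE]
  · exfalso
    obtain ⟨⟨-, k1⟩, ⟨-, k3⟩⟩ := Γ'.twoNode_leaves hf h φ
    obtain ⟨l, hl, hfl⟩ := Γ'.twoNode_flow hf φ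
    simp only [add_assoc, Fin.reduceAdd, add_zero] at k1 k3 hfl
    have hE := expIntegral_pos (a (i + 3) - a (i + 1)) hl
    rw [linearFlow, k1 m2, k3 m0, h02] at hfl
    have : 0 < (a (i + 3) - a (i + 1)) * p i + (b (i + 3) - b (i + 1)) := by linarith
    nlinarith [mul_pos this hE]

end Moduli

/-! ### Comparison of the two degenerations -/

theorem lagrangianGraph_of_affine {f : ℝ → ℝ} {a b : ℝ} (hf : ∀ t, HasDerivAt f (a * t + b) t)
    (ε : ℝ) : lagrangianGraph ε f = {z : ℂ | z.im = ε * (a * z.re + b)} := by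
  simp only [lagrangianGraph, (hf _).deriv]

/-- The coordinates of the convexity of the quadrilateral. -/
theorem affineQuad_of_isConvexCCW {a b p : Fin 4 → ℝ}
    (hcrit : ∀ i, a (i + 1) * p i + b (i + 1) = a i * p i + b i) {x : Fin 4 → ℂ}
    (hx : ∀ i, x i = ⟨p i, a i * p i + b i⟩) (hconv : IsConvexCCW x) : AffineQuad a b p := by
  refine ⟨hcrit, fun i => ?_⟩
  have h3 := hcrit (i + 3)
  simp only [add_assoc, Fin.reduceAdd, add_zero] at h3
  have := hconv i (i + 3) (by simp) (by simp)
  rw [hx (i + 1), hx i, hx (i + 3)] at this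
  simp only [Complex.sub_re, Complex.sub_im] at this
  have e1 := hcrit i
  calc 0 < _ := this
    _ = _ := by
      linear_combination (p (i + 1) - p i) * (-h3) - (p (i + 3) - p i) * e1

theorem lemma4p8
    (f : Fin 4 → ℝ → ℝ) (hf : ∀ i, IsAffineSection (f i))
    (p : Fin 4 → ℝ) (hp : ∀ i, deriv (fun y => f (i + 1) y - f i y) (p i) = 0)
    (x : ℝ → Fin 4 → ℂ)
    (hx : ∀ ε > 0, ∀ i,
      lagrangianGraph ε (f i) ∩ lagrangianGraph ε (f (i + 1)) = {x ε i})
    (hconv : ∀ ε > 0, IsConvexCCW (x ε))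
    (z₄ : ℝ → ℝ) (hz₄ : ∀ ε > 0, z₄ ε ∈ Set.Ioo (0 : ℝ) 1)
    (w : ℝ → ℂ → ℂ)
    (hw : ∀ ε > 0, IsSchwarzChristoffel (fun i => lagrangianGraph ε (f i)) (x ε) (z₄ ε) (w ε)) :
    ∃ Γ : GradientTree f p, (∀ Γ' : GradientTree f p, Nonempty (Γ'.Iso Γ)) ∧
      ∃ T : RibbonTree 4, IsDegenerationTree z₄ T ∧ Nonempty (T.Iso Γ.tree) := by
  choose a b hab using hf
  have hcrit : ∀ i, a (i + 1) * p i + b (i + 1) = a i * p i + b i := by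
    intro i
    have := hp i
    rw [deriv_sub_of_affine (hab _) (hab _)] at this
    linarith
  have hL : ∀ ε > 0, ∀ i, lagrangianGraph ε (f i) = {z : ℂ | z.im = ε * (a i * z.re + b i)} :=
    fun ε _ i => lagrangianGraph_of_affine (hab i) ε
  have hx' : ∀ ε > 0, ∀ i, x ε i = ⟨p i, ε * (a i * p i + b i)⟩ := by
    intro ε hε i
    have hmem : (⟨p i, ε * (a i * p i + b i)⟩ : ℂ) ∈
        lagrangianGraph ε (f i) ∩ lagrangianGraph ε (f (i + 1)) := by
      rw [hL ε hε, hL ε hε]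
      refine ⟨rfl, ?_⟩
      change ε * (a i * p i + b i) = ε * (a (i + 1) * p i + b (i + 1))
      rw [hcrit]
    rw [hx ε hε i] at hmem
    exact (Set.mem_singleton_iff.1 hmem).symm
  -- The coefficients do not depend on ε, so convexity at ε = 1 suffices.
  have hquad : AffineQuad a b p := affineQuad_of_isConvexCCW hcrit
    (fun i => by rw [hx' 1 one_pos i, one_mul]) (hconv 1 one_pos)
  rcases hquad.separated_or_aligned with ⟨i, hi⟩ | ⟨i, hi⟩
  · obtain ⟨Γ, huniq, ⟨ψ⟩⟩ := hquad.exists_gradientTree_of_isSeparated hab hi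
    have hlim := hquad.tendsto_of_isSeparated hx' hL hconv hz₄ hw hi
    refine ⟨Γ, huniq, ?_⟩
    -- The radius tending to 1 is 1 - z₄ for even i and z₄ for odd i.
    have h0 : i = 0 ∨ i = 2 → Tendsto z₄ (𝓝[>] 0) (𝓝 0) := by
      intro h
      simpa [arcRadius, h] using hlim
    have h1 : ¬ (i = 0 ∨ i = 2) → Tendsto z₄ (𝓝[>] 0) (𝓝 1) := by
      intro h
      simp only [arcRadius, h, if_false] at hlim
      simpa using hlim.const_sub 1
    rcases fin_four_cases 0 i with rfl | rfl | rfl | rfl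
    · exact ⟨_, .collision_z₃ (h0 (by decide)), ⟨ψ⟩⟩
    · exact ⟨_, .collision_z₁ (h1 (by decide)), ⟨ψ⟩⟩
    -- For i = 2 and i = 3 the gradient tree has the type of the collision tree with its interior
    -- vertices exchanged.
    · exact ⟨_, .collision_z₃ (h0 (by decide)), ⟨(twoNodeSwap 0).trans ψ⟩⟩
    · exact ⟨_, .collision_z₁ (h1 (by decide)), ⟨(twoNodeSwap 1).trans ψ⟩⟩
  · obtain ⟨Γ, huniq, ⟨ψ⟩⟩ := hquad.exists_gradientTree_of_isAligned hab hi
    exact ⟨Γ, huniq, corolla,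
      .no_collision (hquad.bounded_of_isAligned hx' hL hconv hz₄ hw hi), ⟨ψ⟩⟩
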